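/- For a finite alphabet $\Sigma$ let $F(\Sigma)$ be the free group on $\Sigma$. Let $\Gamma$ be a finitely generated group; elements of $\Gamma$ are given by words in a finite generating set, and a homomorphism $F(\Sigma)\to\Gamma$ is given by the images of the letters of $\Sigma$. The kernel-based Post correspondence problem (PCP) for $\Gamma$ asks, given $\Sigma$ and homomorphisms $g,h\colon F(\Sigma)\to\Gamma$, whether there is $x\in F(\Sigma)$ with $g(x)=h(x)$ and $x\notin\ker(g)\cap\ker(h)$. The non-homogeneous problem (NPCP) for $\Gamma$ asks, given $\Sigma$, $g$, $h$ and $u_1,u_2,v_1,v_2\in\Gamma$, whether there is $x\in F(\Sigma)\setminus\{1\}$ with $u_1g(x)u_2=v_1h(x)v_2$. A group $\Gamma$ is virtually $K$ if it contains an embedded copy of $K$ as a subgroup of finite index. **Proposition 4.3.** Let $K$ be a finitely presented group for which the kernel-based PCP and the NPCP are both decidable. Then the kernel-based PCP is decidable for virtually $K$ groups: it is decidable for each virtually $K$ group $\Gamma$ and, moreover, there is a single algorithm (depending only on $K$) which takes as input a finite presentation of a virtually $K$ group $\Gamma=\langle\Delta\rangle$, a finite set $\Delta_K$ of words over $\Delta^{\pm1}$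 which generates a finite-index subgroup of $\Gamma$ isomorphic to $K$, and an instance $(\Sigma,g,h)$ of the PCP for $\Gamma$, and decides whether this instance has a solution. -/

import Mathlib

/-! ### The two correspondence problems for a pair of homomorphisms -/

/-- The kernel-based Post correspondence problem: there is `x` in the equaliser `Eq(g, h)` outside
`ker g ∩ ker h`, i.e. the group `Eq(g, h) / (ker g ∩ ker h)` is non-trivial. -/
def HasPCPSolution {S G : Type*} [Group G] (g h : FreeGroup S →* G) : Prop :=
  ∃ x : FreeGroup S, x ∈ g.eqLocus h ∧ x ∉ g.ker ⊓ h.ker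

/-- The non-homogeneous Post correspondence problem: there is `x ≠ 1` in the free group with
`u₁ g(x) u₂ = v₁ h(x) v₂`. -/
def HasNPCPSolution {S G : Type*} [Group G] (g h : FreeGroup S →* G) (u₁ u₂ v₁ v₂ : G) : Prop :=
  ∃ x : FreeGroup S, x ≠ 1 ∧ u₁ * g x * u₂ = v₁ * h x * v₂

/-! ### Finite encodings of instances -/

/-- Group words: the letter `(i, true)` stands for the `i`-th generator and `(i, false)` for its
inverse. -/
abbrev GroupWord : Type := List (ℕ × Bool)

/-- The value of a letter, for the generators `x 0, …, x (k - 1)` of `G`. Letters whose index is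
not below `k` are blank: their value is `1`. -/
def letterValue {k : ℕ} {G : Type*} [Group G] (x : Fin k → G) (a : ℕ × Bool) : G :=
  if hk : a.1 < k then (if a.2 = true then x ⟨a.1, hk⟩ else (x ⟨a.1, hk⟩)⁻¹) else 1

/-- The value of a word in `G`. -/
def wordValue {k : ℕ} {G : Type*} [Group G] (x : Fin k → G) (w : GroupWord) : G :=
  (w.map (letterValue x)).prod

/-- A pair of homomorphisms from a free group on a finite alphabet `Σ = Fin n` to a group with
chosen generators: the list of the `n` pairs of words that represent `(g(a), h(a))` for
`a = 0, …, n - 1`. -/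
abbrev HomPairCode : Type := List (GroupWord × GroupWord)

/-- The homomorphism `g` encoded by a list of pairs of words. -/
def HomPairCode.fstHom {k : ℕ} {G : Type*} [Group G] (x : Fin k → G) (I : HomPairCode) :
    FreeGroup (Fin (List.length I)) →* G :=
  FreeGroup.lift fun a => wordValue x (List.get I a).1

/-- The homomorphism `h` encoded by a list of pairs of words. -/
def HomPairCode.sndHom {k : ℕ} {G : Type*} [Group G] (x : Fin k → G) (I : HomPairCode) :
    FreeGroup (Fin (List.length I)) →* G :=
  FreeGroup.lift fun a => wordValue x (List.get I a).2

/-- The instance of the PCP encoded by `I` has a solution. -/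
def PCPSolvable {k : ℕ} {G : Type*} [Group G] (x : Fin k → G) (I : HomPairCode) : Prop :=
  HasPCPSolution (HomPairCode.fstHom x I) (HomPairCode.sndHom x I)

/-- Codes of instances of the NPCP: a pair of homomorphisms and the words for
`u₁, u₂, v₁, v₂`. -/
abbrev NPCPCode : Type :=
  HomPairCode × GroupWord × GroupWord × GroupWord × GroupWord

/-- The instance of the NPCP encoded by `J = (I, u₁, u₂, v₁, v₂)` has a solution. -/
def NPCPSolvable {k : ℕ} {G : Type*} [Group G] (x : Fin k → G) (J : NPCPCode) : Prop :=
  HasNPCPSolution (HomPairCode.fstHom x J.1) (HomPairCode.sndHom x J.1)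
    (wordValue x J.2.1) (wordValue x J.2.2.1) (wordValue x J.2.2.2.1) (wordValue x J.2.2.2.2)

/-! ### Decidability for a fixed group -/

/-- The kernel-based PCP is decidable for the finitely generated group `G`: for some finite
generating tuple, an algorithm decides it on all instances written in these generators.
(Rewriting words from one finite generating tuple into another is computable, so the choice of the
tuple does not matter.) -/
def PCPDecidable (G : Type*) [Group G] : Prop :=
  ∃ (k : ℕ) (x : Fin k → G), Subgroup.closure (Set.range x) = ⊤ ∧
    ComputablePred fun I : HomPairCode => PCPSolvable x I

/-- The NPCP is decidable for the finitely generated group `G`. -/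
def NPCPDecidable (G : Type*) [Group G] : Prop :=
  ∃ (k : ℕ) (x : Fin k → G), Subgroup.closure (Set.range x) = ⊤ ∧
    ComputablePred fun J : NPCPCode => NPCPSolvable x J

/-! ### Virtually `K` groups -/

/-- `G` is virtually `K`: it contains an embedded copy of `K` as a subgroup of finite index. -/
def IsVirtually (K G : Type*) [Group K] [Group G] : Prop :=
  ∃ f : K →* G, Function.Injective f ∧ f.range.FiniteIndex

/-! ### Virtually `K` groups as inputs of an algorithm -/

/-- The relators in the free group on `k` letters given by a finite list of words. -/
def relatorSet (k : ℕ) (R : List GroupWord) : Set (FreeGroup (Fin k)) :=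
  {r | ∃ w ∈ R, r = wordValue (fun i : Fin k => FreeGroup.of i) w}

/-- The group with `k` generators and the finite list of relators `R`. -/
abbrev FinPresGroup (k : ℕ) (R : List GroupWord) : Type :=
  PresentedGroup (relatorSet k R)

/-- The `k` generators of the group presented by `k` and `R`. -/
def FinPresGroup.gen (k : ℕ) (R : List GroupWord) (i : Fin k) : FinPresGroup k R :=
  PresentedGroup.of i

/-- A finite presentation `(k, R)` together with a finite list `D` of words in its generators. -/
abbrev OvergroupCode : Type := ℕ × List GroupWord × List GroupWord

/-- The code `(k, R, D)` is that of a virtually `K` group: in the group presented by `(k, R)`, the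
words in `D` generate a subgroup which is isomorphic to `K` and of finite index. -/
def OvergroupCode.IsVirtuallyCode (K : Type*) [Group K] (c : OvergroupCode) : Prop :=
  ∃ f : K →* FinPresGroup c.1 c.2.1, Function.Injective f ∧ f.range.FiniteIndex ∧
    f.range = Subgroup.closure {d | ∃ w ∈ c.2.2, d = wordValue (FinPresGroup.gen c.1 c.2.1) w}

/-- The PCP is decidable for virtually `K` groups by one algorithm: it takes as input a finite
presentation of a virtually `K` group `G`, a finite generating set of a finite-index copy of `K` in
`G`, and an instance of the PCP for `G`; on all such inputs it halts, with the right answer. -/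
def UniformPCPDecidableForVirtually (K : Type*) [Group K] : Prop :=
  ∃ A : OvergroupCode × HomPairCode →. Bool, Partrec A ∧
    ∀ (c : OvergroupCode) (I : HomPairCode), OvergroupCode.IsVirtuallyCode K c →
      ∃ b ∈ A (c, I), (b = true ↔ PCPSolvable (FinPresGroup.gen c.1 c.2.1) I)

/-!
Let `H ≅ K` have finite index in `G`. Right multiplication of `G` on itself is a right action on
(cosets of `H`) `× K` of the form `(q, k) · g = (state q g, k * label q g)`; a finite transducer,
reading words in the generators of `G`, computes states and labels (`FreeCocycle`,
`TransducerTable.Computes`). The stabiliser of the point `(0, 1)` is trivial, so that an element of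
`G` is determined by its state and its label at `0`.

For `g, h : F(Σ) → G`, let `F'` be the finite-index subgroup of those `x` for which `g x` and `h x`
both fix the state `0`. On `F'` the labels of `g x` and `h x` form an instance of the kernel-based
problem for `K`, whose solutions are the solutions in `F'`. A solution outside `F'` is `y * t` with
`y ∈ F'` and `t` from a finite set of representatives for which `g t` and `h t` lead to the same
state `≠ 0`; conversely such a product is a solution as soon as its two labels agree, and it is
automatically outside the kernels. This is an instance of the non-homogeneous problem for `K`. An
extra letter that is mapped to `1` makes up for the condition `y ≠ 1` there. The generators of
`F'` and the representatives are found among all words of bounded length, by a quantitative Schreier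
lemma (`wordValue_mem_closure_short_loops`); no free basis of `F'` is needed, since only the
*values* of the homomorphisms on `F'` matter. The outcome is `TransducerTable.Computes.pcpSolvable_iff`,
and since the reduction is primitive recursive in the table as well, it settles single groups and
leaves the uniform algorithm with the task of finding a table.

That is done by unbounded search for a certificate (`CosetCertificate.IsValid`): a table, words for
coset representatives `t_q` and for a homomorphism `f : K → G`, and derivations of finitely many
word identities, namely that the relators of `K` hold under `f`, that the relators of `G` act
trivially through the table, and that `t_q * a = f u * t_s` for each transition from `q` to `s` with
input `a` and output `u`. The identities make the table define an action of `G`, and that action is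
free because `(q, k) ↦ f k * t_q` is equivariant; so a valid certificate is sound even without
knowing that `f` is injective. When `K` does embed with finite index, a certificate exists, because
triviality of words in a finitely presented group is recursively enumerable (`exists_derives`). In
particular the words that generate the copy of `K` need not be consulted.
-/

/-! ### Words and their values -/

section Words

variable {G H : Type*} [Group G] [Group H] {k m : ℕ}

theorem letterValue_not (x : Fin k → G) (i : ℕ) (b : Bool) :
    letterValue x (i, !b) = (letterValue x (i, b))⁻¹ := by
  by_cases hi : i < k <;> cases b <;> simp [letterValue, hi]

theorem letterValue_of_le (x : Fin k → G) {a : ℕ × Bool} (ha : k ≤ a.1) :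
    letterValue x a = 1 := by
  simp [letterValue, Nat.not_lt.mpr ha]

theorem letterValue_true (x : Fin k → G) (i : Fin k) : letterValue x ((i : ℕ), true) = x i := by
  simp [letterValue]

theorem map_letterValue (φ : G →* H) (x : Fin k → G) (a : ℕ × Bool) :
    φ (letterValue x a) = letterValue (fun i => φ (x i)) a := by
  unfold letterValue
  split_ifs <;> simp

@[simp]
theorem wordValue_nil (x : Fin k → G) : wordValue x [] = 1 := rfl

@[simp]
theorem wordValue_cons (x : Fin k → G) (a : ℕ × Bool) (w : GroupWord) :
    wordValue x (a :: w) = letterValue x a * wordValue x w := by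
  simp [wordValue]

@[simp]
theorem wordValue_append (x : Fin k → G) (v w : GroupWord) :
    wordValue x (v ++ w) = wordValue x v * wordValue x w := by
  simp [wordValue]

@[simp]
theorem wordValue_invRev (x : Fin k → G) (w : GroupWord) :
    wordValue x (FreeGroup.invRev w) = (wordValue x w)⁻¹ := by
  induction w with
  | nil => simp
  | cons a w ih =>
    have h : wordValue x (FreeGroup.invRev [a]) = (letterValue x a)⁻¹ := by
      obtain ⟨i, b⟩ := a
      simpa [FreeGroup.invRev] using letterValue_not x i b
    rw [FreeGroup.invRev_cons, wordValue_append, ih, h, wordValue_cons, mul_inv_rev]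

theorem map_wordValue (φ : G →* H) (x : Fin k → G) (w : GroupWord) :
    φ (wordValue x w) = wordValue (fun i => φ (x i)) w := by
  induction w with
  | nil => simp
  | cons a w ih => simp [ih, map_letterValue]

/-- The subgroup generated by a tuple consists of the values of the words in this tuple. -/
theorem mem_closure_range_iff (x : Fin k → G) (g : G) :
    g ∈ Subgroup.closure (Set.range x) ↔ ∃ w, wordValue x w = g := by
  constructor
  · intro hg
    induction hg using Subgroup.closure_induction with
    | mem g hg =>
      obtain ⟨i, rfl⟩ := hg
      exact ⟨[((i : ℕ), true)], by simp [letterValue_true]⟩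
    | one => exact ⟨[], rfl⟩
    | mul g h _ _ ihg ihh =>
      obtain ⟨v, rfl⟩ := ihg
      obtain ⟨w, rfl⟩ := ihh
      exact ⟨v ++ w, by simp⟩
    | inv g _ ih =>
      obtain ⟨v, rfl⟩ := ih
      exact ⟨FreeGroup.invRev v, by simp⟩
  · rintro ⟨w, rfl⟩
    induction w with
    | nil => exact one_mem _
    | cons a w ih =>
      rw [wordValue_cons]
      refine mul_mem ?_ ih
      unfold letterValue
      split_ifs with h1 h2
      · exact Subgroup.subset_closure ⟨_, rfl⟩
      · exact inv_mem (Subgroup.subset_closure ⟨_, rfl⟩)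
      · exact one_mem _

theorem exists_wordValue_eq {x : Fin k → G} (hx : Subgroup.closure (Set.range x) = ⊤) (g : G) :
    ∃ w, wordValue x w = g :=
  (mem_closure_range_iff x g).1 (hx ▸ Subgroup.mem_top g)

theorem exists_wordValue_of_eq (z : FreeGroup (Fin k)) :
    ∃ w, wordValue (FreeGroup.of : Fin k → FreeGroup (Fin k)) w = z :=
  exists_wordValue_eq (FreeGroup.closure_range_of _) z

theorem lift_wordValue_of (x : Fin k → G) (w : GroupWord) :
    FreeGroup.lift x (wordValue (FreeGroup.of : Fin k → FreeGroup (Fin k)) w) = wordValue x w := by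
  rw [map_wordValue]
  simp

theorem wordValue_prodMk (x : Fin k → G) (y : Fin k → H) (w : GroupWord) :
    wordValue (fun i => (x i, y i)) w = (wordValue x w, wordValue y w) :=
  Prod.ext (map_wordValue (MonoidHom.fst G H) (fun i => (x i, y i)) w)
    (map_wordValue (MonoidHom.snd G H) (fun i => (x i, y i)) w)

/-- Substitution of the words of the list `D` for the letters of a word; the letters beyond the
length of `D` are deleted. -/
def substWord (D : List GroupWord) (w : GroupWord) : GroupWord :=
  w.flatMap fun a => bif a.2 then D.getD a.1 [] else FreeGroup.invRev (D.getD a.1 [])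

@[simp]
theorem substWord_nil (D : List GroupWord) : substWord D [] = [] := rfl

theorem substWord_cons (D : List GroupWord) (a : ℕ × Bool) (w : GroupWord) :
    substWord D (a :: w) =
      (bif a.2 then D.getD a.1 [] else FreeGroup.invRev (D.getD a.1 [])) ++ substWord D w := rfl

theorem wordValue_substWord (x : Fin k → G) (D : List GroupWord) (w : GroupWord) :
    wordValue x (substWord D w) = wordValue (fun i : Fin D.length => wordValue x (D.get i)) w := by
  induction w with
  | nil => simp
  | cons a w ih =>
    rw [substWord_cons, wordValue_append, wordValue_cons, ih]
    congr 1
    obtain ⟨i, b⟩ := a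
    by_cases hi : i < D.length <;> cases b <;> simp [letterValue, hi]

/-- The values of words in two tuples agree once they agree letter by letter, up to transport of
the length of the tuple. -/
theorem wordValue_congr {x : Fin k → G} {y : Fin m → G} (hkm : k = m)
    (h : ∀ (i : ℕ) (hk : i < k) (hm : i < m), x ⟨i, hk⟩ = y ⟨i, hm⟩) (w : GroupWord) :
    wordValue x w = wordValue y w := by
  subst hkm
  congr 1
  funext i
  exact h i i.2 i.2

end Words

/-! ### The correspondence problems in terms of words -/

section Instances

variable {G H : Type*} [Group G] [Group H] {k m : ℕ}

theorem fstHom_wordValue (x : Fin k → G) (I : HomPairCode) (w : GroupWord) :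
    HomPairCode.fstHom x I (wordValue FreeGroup.of w) =
      wordValue x (substWord (I.map Prod.fst) w) := by
  rw [HomPairCode.fstHom, lift_wordValue_of, wordValue_substWord]
  exact wordValue_congr (by simp) (by simp) w

theorem sndHom_wordValue (x : Fin k → G) (I : HomPairCode) (w : GroupWord) :
    HomPairCode.sndHom x I (wordValue FreeGroup.of w) =
      wordValue x (substWord (I.map Prod.snd) w) := by
  rw [HomPairCode.sndHom, lift_wordValue_of, wordValue_substWord]
  exact wordValue_congr (by simp) (by simp) w

theorem pcpSolvable_iff (x : Fin k → G) (I : HomPairCode) :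
    PCPSolvable x I ↔ ∃ w : GroupWord,
      wordValue x (substWord (I.map Prod.fst) w) = wordValue x (substWord (I.map Prod.snd) w) ∧
        wordValue x (substWord (I.map Prod.fst) w) ≠ 1 := by
  constructor
  · rintro ⟨z, hz, hz'⟩
    obtain ⟨w, rfl⟩ := exists_wordValue_of_eq z
    have h : HomPairCode.fstHom x I _ = HomPairCode.sndHom x I _ := hz
    simp only [Subgroup.mem_inf, MonoidHom.mem_ker, ← h, and_self] at hz'
    rw [fstHom_wordValue, sndHom_wordValue] at h
    rw [fstHom_wordValue] at hz'
    exact ⟨w, h, hz'⟩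
  · rintro ⟨w, h, h'⟩
    refine ⟨wordValue FreeGroup.of w, ?_, fun hk => h' ?_⟩
    · change HomPairCode.fstHom x I _ = HomPairCode.sndHom x I _
      rw [fstHom_wordValue, sndHom_wordValue, h]
    · rw [← fstHom_wordValue]
      exact hk.1

theorem npcpSolvable_iff (x : Fin k → G) (I : HomPairCode) (u₁ u₂ v₁ v₂ : GroupWord) :
    NPCPSolvable x (I, u₁, u₂, v₁, v₂) ↔ ∃ w : GroupWord,
      wordValue (FreeGroup.of : Fin I.length → _) w ≠ 1 ∧
        wordValue x u₁ * wordValue x (substWord (I.map Prod.fst) w) * wordValue x u₂ =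
          wordValue x v₁ * wordValue x (substWord (I.map Prod.snd) w) * wordValue x v₂ := by
  constructor
  · rintro ⟨z, hz, h⟩
    obtain ⟨w, rfl⟩ := exists_wordValue_of_eq z
    rw [fstHom_wordValue, sndHom_wordValue] at h
    exact ⟨w, hz, h⟩
  · rintro ⟨w, hw, h⟩
    refine ⟨_, hw, ?_⟩
    rw [fstHom_wordValue, sndHom_wordValue]
    exact h

/-- Adding a letter that both homomorphisms kill removes the requirement `x ≠ 1` from the
non-homogeneous problem. -/
theorem npcpSolvable_nil_cons_iff (x : Fin k → G) (I : HomPairCode) (u v : GroupWord) :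
    NPCPSolvable x (([], []) :: I, [], u, [], v) ↔ ∃ w : GroupWord,
      wordValue x (substWord (I.map Prod.fst) w) * wordValue x u =
        wordValue x (substWord (I.map Prod.snd) w) * wordValue x v := by
  -- The shift `a ↦ a + 1` of letters, and its inverse, which deletes the letter `0`.
  let up : GroupWord → GroupWord := List.map fun a => (a.1 + 1, a.2)
  have hup (D : List GroupWord) (w : GroupWord) : substWord ([] :: D) (up w) = substWord D w := by
    simp [substWord, up, List.flatMap_map]
  let down : GroupWord → GroupWord :=
    List.flatMap fun a => if a.1 = 0 then [] else [(a.1 - 1, a.2)]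
  have hdown (D : List GroupWord) (w : GroupWord) :
      substWord D (down w) = substWord ([] :: D) w := by
    induction w with
    | nil => rfl
    | cons a w ih =>
      have h1 : down (a :: w) = (if a.1 = 0 then [] else [(a.1 - 1, a.2)]) ++ down w := rfl
      obtain ⟨i, b⟩ := a
      rw [h1, substWord_cons, ← ih]
      cases i <;> cases b <;> simp [substWord]
  rw [npcpSolvable_iff]
  simp only [List.map_cons, wordValue_nil, one_mul]
  constructor
  · rintro ⟨w, -, h⟩
    exact ⟨down w, by rwa [hdown, hdown]⟩
  · rintro ⟨w, h⟩
    by_cases hw : wordValue (FreeGroup.of : Fin (([], []) :: I : HomPairCode).length → _)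
        (up w) = 1
    · refine ⟨(0, true) :: up w, ?_, ?_⟩
      · rw [wordValue_cons, hw, mul_one]
        simp [letterValue]
      · simpa [substWord_cons, hup] using h
    · exact ⟨up w, hw, by simpa [hup] using h⟩

/-- Rewriting an instance over generators `z` into one over generators `x`. -/
def HomPairCode.rewrite (D : List GroupWord) (I : HomPairCode) : HomPairCode :=
  I.map fun p => (substWord D p.1, substWord D p.2)

variable {x : Fin k → G} {z : Fin m → H} {φ : G →* H} {D : List GroupWord}

theorem wordValue_eq_map_substWord (hm : D.length = m)
    (hz : ∀ i : Fin m, z i = φ (wordValue x (D.getD i []))) (w : GroupWord) :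
    wordValue z w = φ (wordValue x (substWord D w)) := by
  rw [wordValue_substWord, map_wordValue]
  exact wordValue_congr hm.symm (by intro i h1 h2; simp [hz, h2]) w

theorem wordValue_substWord_rewrite (hm : D.length = m)
    (hz : ∀ i : Fin m, z i = φ (wordValue x (D.getD i []))) (L : List GroupWord)
    (w : GroupWord) :
    wordValue z (substWord L w) = φ (wordValue x (substWord (L.map (substWord D)) w)) := by
  rw [wordValue_substWord, wordValue_substWord, map_wordValue]
  exact wordValue_congr (by simp)
    (by intro i h1 h2; simp [wordValue_eq_map_substWord hm hz]) w

theorem pcpSolvable_rewrite_iff (hφ : Function.Injective φ) (hm : D.length = m)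
    (hz : ∀ i : Fin m, z i = φ (wordValue x (D.getD i []))) (I : HomPairCode) :
    PCPSolvable z I ↔ PCPSolvable x (I.rewrite D) := by
  rw [pcpSolvable_iff, pcpSolvable_iff]
  refine exists_congr fun w => ?_
  have h1 : (I.rewrite D).map Prod.fst = (I.map Prod.fst).map (substWord D) := by
    simp [HomPairCode.rewrite]
  have h2 : (I.rewrite D).map Prod.snd = (I.map Prod.snd).map (substWord D) := by
    simp [HomPairCode.rewrite]
  rw [h1, h2, wordValue_substWord_rewrite hm hz, wordValue_substWord_rewrite hm hz, hφ.eq_iff,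
    Ne, map_eq_one_iff φ hφ]

theorem npcpSolvable_rewrite_iff (hφ : Function.Injective φ) (hm : D.length = m)
    (hz : ∀ i : Fin m, z i = φ (wordValue x (D.getD i []))) (I : HomPairCode)
    (u₁ u₂ v₁ v₂ : GroupWord) :
    NPCPSolvable z (I, u₁, u₂, v₁, v₂) ↔
      NPCPSolvable x (I.rewrite D, substWord D u₁, substWord D u₂, substWord D v₁,
        substWord D v₂) := by
  rw [npcpSolvable_iff, npcpSolvable_iff]
  refine exists_congr fun w => and_congr ?_ ?_
  · rw [HomPairCode.rewrite, List.length_map]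
  · have h1 : (I.rewrite D).map Prod.fst = (I.map Prod.fst).map (substWord D) := by
      simp [HomPairCode.rewrite]
    have h2 : (I.rewrite D).map Prod.snd = (I.map Prod.snd).map (substWord D) := by
      simp [HomPairCode.rewrite]
    rw [h1, h2, wordValue_substWord_rewrite hm hz, wordValue_substWord_rewrite hm hz,
      wordValue_eq_map_substWord hm hz u₁, wordValue_eq_map_substWord hm hz u₂,
      wordValue_eq_map_substWord hm hz v₁, wordValue_eq_map_substWord hm hz v₂]
    simp only [← map_mul, hφ.eq_iff]

end Instances

/-! ### Computability of the operations on words -/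

section Computability

variable {α β : Type*} [Primcodable α] [Primcodable β]

theorem Primrec.invRev : Primrec (FreeGroup.invRev : GroupWord → GroupWord) :=
  Primrec.list_reverse.comp (Primrec.list_map Primrec.id
    ((Primrec.fst.comp Primrec.snd).pair
      (Primrec.not.comp (Primrec.snd.comp Primrec.snd))).to₂)

theorem Primrec.substWord : Primrec₂ substWord := by
  have hD : Primrec fun p : (List GroupWord × GroupWord) × (ℕ × Bool) =>
      p.1.1.getD p.2.1 [] :=
    (Primrec.list_getD []).comp (Primrec.fst.comp Primrec.fst) (Primrec.fst.comp Primrec.snd)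
  exact Primrec.list_flatMap (f := fun p : List GroupWord × GroupWord => p.2) Primrec.snd
    (Primrec.cond (Primrec.snd.comp Primrec.snd) hD (Primrec.invRev.comp hD)).to₂

theorem Primrec.rewrite (D : List GroupWord) : Primrec (HomPairCode.rewrite D) :=
  Primrec.list_map Primrec.id
    ((Primrec.substWord.comp (Primrec.const D) (Primrec.fst.comp Primrec.snd)).pair
      (Primrec.substWord.comp (Primrec.const D) (Primrec.snd.comp Primrec.snd))).to₂

theorem ComputablePred.comp {p : β → Prop} (hp : ComputablePred p) {f : α → β}
    (hf : Computable f) : ComputablePred fun a => p (f a) := by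
  obtain ⟨_, hp⟩ := hp
  exact ⟨fun a => inferInstance, hp.comp hf⟩

theorem ComputablePred.or {p q : α → Prop} (hp : ComputablePred p) (hq : ComputablePred q) :
    ComputablePred fun a => p a ∨ q a := by
  obtain ⟨_, hp⟩ := hp
  obtain ⟨_, hq⟩ := hq
  refine ⟨fun a => inferInstance, ?_⟩
  exact (Primrec.or.to_comp.comp hp hq).of_eq fun a => by simp

theorem ComputablePred.exists_mem_list {p : β → Prop} (hp : ComputablePred p) :
    ComputablePred fun L : List β => ∃ a ∈ L, p a := by
  classical
  have hp := hp.decide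
  have hstep : Computable fun q : List β × ℕ × Bool =>
      q.2.2 || ((q.1[q.2.1]?).map fun b => decide (p b)).getD false :=
    Primrec.or.to_comp.comp (Computable.snd.comp Computable.snd)
      (Computable.option_getD (Computable.option_map
        (Computable.list_getElem?.comp Computable.fst (Computable.fst.comp Computable.snd))
        (hp.comp Computable.snd).to₂) (Computable.const false))
  have hrec : Computable fun L : List β => Nat.rec (motive := fun _ => Bool) false
      (fun i b => b || ((L[i]?).map fun b => decide (p b)).getD false) L.length :=
    Computable.nat_rec (σ := Bool) Computable.list_length (Computable.const false) hstep.to₂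
  have key (L : List β) (n : ℕ) : (Nat.rec (motive := fun _ => Bool) false
      (fun i b => b || ((L[i]?).map fun b => decide (p b)).getD false) n = true) ↔
        ∃ i < n, ∃ b, L[i]? = some b ∧ p b := by
    induction n with
    | zero => simp
    | succ n ih =>
      simp only [Bool.or_eq_true, ih, Nat.lt_succ_iff_lt_or_eq, or_and_right, exists_or,
        exists_eq_left]
      refine or_congr Iff.rfl ?_
      cases L[n]? <;> simp
  refine ComputablePred.computable_iff.2 ⟨_, hrec, ?_⟩
  funext L
  rw [eq_iff_iff, key]
  constructor
  · rintro ⟨b, hb, h⟩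
    obtain ⟨i, hi, rfl⟩ := List.getElem_of_mem hb
    exact ⟨i, hi, _, List.getElem?_eq_getElem hi, h⟩
  · rintro ⟨i, -, b, hb, h⟩
    exact ⟨b, List.mem_of_getElem? hb, h⟩

end Computability

section ChangeOfGenerators

variable {G H : Type*} [Group G] [Group H]

/-- The letters of a tuple in `H` can be rewritten as words in a generating tuple of a group
isomorphic to `H`. -/
theorem exists_rewriting_list {k m : ℕ} {x : Fin k → G}
    (hx : Subgroup.closure (Set.range x) = ⊤) (e : G ≃* H) (z : Fin m → H) :
    ∃ D : List GroupWord, D.length = m ∧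
      ∀ i : Fin m, z i = e.toMonoidHom (wordValue x (D.getD i [])) := by
  choose u hu using fun i => exists_wordValue_eq hx (e.symm (z i))
  exact ⟨List.ofFn u, by simp, fun i => by simp [hu]⟩

/-- Decidability of the kernel-based problem does not depend on the tuple, which need not even
generate, and passes to isomorphic groups. -/
theorem PCPDecidable.computablePred (h : PCPDecidable G) (e : G ≃* H) {m : ℕ} (z : Fin m → H) :
    ComputablePred fun I : HomPairCode => PCPSolvable z I := by
  obtain ⟨k, x, hx, hdec⟩ := h
  obtain ⟨D, hm, hz⟩ := exists_rewriting_list hx e z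
  exact (hdec.comp (Primrec.rewrite D).to_comp).of_eq fun I =>
    (pcpSolvable_rewrite_iff e.injective hm hz I).symm

theorem NPCPDecidable.computablePred (h : NPCPDecidable G) (e : G ≃* H) {m : ℕ}
    (z : Fin m → H) : ComputablePred fun J : NPCPCode => NPCPSolvable z J := by
  obtain ⟨k, x, hx, hdec⟩ := h
  obtain ⟨D, hm, hz⟩ := exists_rewriting_list hx e z
  have hs {f : NPCPCode → GroupWord} (hf : Primrec f) :
      Primrec fun J => substWord D (f J) := Primrec.substWord.comp (Primrec.const D) hf
  have hf : Primrec fun J : NPCPCode => ((J.1.rewrite D, substWord D J.2.1, substWord D J.2.2.1,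
      substWord D J.2.2.2.1, substWord D J.2.2.2.2) : NPCPCode) := by
    have h2 := Primrec.snd (α := HomPairCode)
      (β := GroupWord × GroupWord × GroupWord × GroupWord)
    have h3 := Primrec.snd.comp h2
    have h4 := Primrec.snd.comp h3
    exact ((Primrec.rewrite D).comp Primrec.fst).pair ((hs (Primrec.fst.comp h2)).pair
      ((hs (Primrec.fst.comp h3)).pair
        ((hs (Primrec.fst.comp h4)).pair (hs (Primrec.snd.comp h4)))))
  exact (hdec.comp hf.to_comp).of_eq fun J =>
    (npcpSolvable_rewrite_iff e.injective hm hz J.1 J.2.1 J.2.2.1 J.2.2.2.1 J.2.2.2.2).symm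

end ChangeOfGenerators

/-! ### Free cocycles -/

/-- A right action of `G` on the set `Fin (n + 1) × K` of the form
`(q, k) · g = (state q g, k * label q g)`, in which only `1` fixes the point `(0, 1)`. It records
the right multiplication of `G` on itself when a subgroup isomorphic to `K` has the right cosets
indexed by `Fin (n + 1)`. -/
structure FreeCocycle (G K : Type*) [Group G] [Group K] (n : ℕ) where
  /-- The action on the cosets. -/
  state : Fin (n + 1) → G → Fin (n + 1)
  /-- The factor in `K` picked up on the way. -/
  label : Fin (n + 1) → G → K
  state_one : ∀ q, state q 1 = q
  state_mul : ∀ q g h, state q (g * h) = state (state q g) h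
  label_mul : ∀ q g h, label q (g * h) = label q g * label (state q g) h
  eq_one_of_fix : ∀ g, state 0 g = 0 → label 0 g = 1 → g = 1

namespace FreeCocycle

variable {G K : Type*} [Group G] [Group K] {n : ℕ} (c : FreeCocycle G K n)

theorem label_one (q : Fin (n + 1)) : c.label q 1 = 1 := by
  have h := c.label_mul q 1 1
  rwa [mul_one, c.state_one, left_eq_mul] at h

theorem state_mul_inv {g h : G} (hs : c.state 0 g = c.state 0 h) : c.state 0 (g * h⁻¹) = 0 := by
  rw [c.state_mul, hs, ← c.state_mul, mul_inv_cancel, c.state_one]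

theorem label_mul_inv_mul {g h : G} (hs : c.state 0 g = c.state 0 h) :
    c.label 0 (g * h⁻¹) * c.label 0 h = c.label 0 g := by
  have := c.label_mul 0 (g * h⁻¹) h
  rw [c.state_mul_inv hs] at this
  rw [← this, inv_mul_cancel_right]

theorem state_inv {g : G} (hs : c.state 0 g = 0) : c.state 0 g⁻¹ = 0 := by
  simpa using c.state_mul_inv (g := 1) (h := g) (by rw [hs, c.state_one])

theorem label_inv {g : G} (hs : c.state 0 g = 0) : c.label 0 g⁻¹ = (c.label 0 g)⁻¹ := by
  rw [eq_inv_iff_mul_eq_one]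
  simpa [c.label_one] using c.label_mul_inv_mul (g := 1) (h := g) (by rw [hs, c.state_one])

theorem eq_of_state_eq_of_label_eq {g h : G} (hs : c.state 0 g = c.state 0 h)
    (hl : c.label 0 g = c.label 0 h) : g = h := by
  rw [← mul_inv_eq_one]
  refine c.eq_one_of_fix _ (c.state_mul_inv hs) ?_
  have := c.label_mul_inv_mul hs
  rwa [hl, mul_eq_right] at this

end FreeCocycle

open scoped Pointwise in
/-- A finite-index embedding of `K` into `G` gives a free cocycle: for representatives `τ q` of the
right cosets of the image of `f`, it is determined by `τ q * g = f (label q g) * τ (state q g)`. -/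
theorem exists_freeCocycle {G K : Type*} [Group G] [Group K] {f : K →* G}
    (hf : Function.Injective f) (hfin : f.range.FiniteIndex) :
    ∃ (n : ℕ) (c : FreeCocycle G K n) (τ : Fin (n + 1) → G),
      ∀ q g, τ q * g = f (c.label q g) * τ (c.state q g) := by
  have : Nonempty (G ⧸ f.range) := ⟨((1 : G) : G ⧸ f.range)⟩
  obtain ⟨N, ⟨e⟩⟩ := Finite.exists_equiv_fin (G ⧸ f.range)
  obtain ⟨n, rfl⟩ : ∃ n, N = n + 1 := Nat.exists_eq_succ_of_ne_zero (by
    rintro rfl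
    exact (e (Classical.arbitrary _)).elim0)
  -- Left cosets are what Mathlib offers; inverses of their representatives represent right cosets.
  let τ : Fin (n + 1) → G := fun q => (e.symm q).out⁻¹
  let st : Fin (n + 1) → G → Fin (n + 1) := fun q g => e (g⁻¹ • e.symm q)
  have hex (q : Fin (n + 1)) (g : G) : ∃ k : K, f k = τ q * g * (τ (st q g))⁻¹ := by
    have h1 : ((τ (st q g))⁻¹ : G) = (g⁻¹ • e.symm q).out := by simp [τ, st]
    have h2 : (((g⁻¹ • e.symm q).out : G) : G ⧸ f.range) =
        ((g⁻¹ * (e.symm q).out : G) : G ⧸ f.range) := by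
      rw [QuotientGroup.out_eq', ← smul_eq_mul, ← MulAction.Quotient.smul_coe,
        QuotientGroup.out_eq']
    have h3 := QuotientGroup.eq.1 h2.symm
    rw [h1]
    simpa [τ] using h3
  choose lab hlab using hex
  have hτ (q : Fin (n + 1)) (g : G) : τ q * g = f (lab q g) * τ (st q g) := by
    rw [hlab, inv_mul_cancel_right]
  have hmul (q : Fin (n + 1)) (g h : G) : st q (g * h) = st (st q g) h := by
    simp [st, mul_smul]
  refine ⟨n, ⟨st, lab, fun q => by simp [st], hmul, fun q g h => hf ?_, fun g hs hl => ?_⟩, τ, hτ⟩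
  · rw [← mul_left_inj (τ (st q (g * h))), ← hτ, ← mul_assoc, hτ, mul_assoc, hτ, hmul, map_mul,
      mul_assoc]
  · have := hτ 0 g
    rwa [hs, hl, map_one, one_mul, mul_eq_left] at this

/-! ### Short Schreier generators -/

section Schreier

variable {M V : Type*} [Group M] [Fintype V] {L : ℕ} (z : Fin L → M) {act : V → M → V}

/-- Every point of an orbit is reached by a word that is no longer than the number of points. -/
theorem exists_short_word (hone : ∀ v, act v 1 = v)
    (hmul : ∀ v g h, act v (g * h) = act (act v g) h) (v : V) (w : GroupWord) :
    ∃ t : GroupWord, t.length ≤ Fintype.card V ∧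
      act v (wordValue z t) = act v (wordValue z w) := by
  let A : DFA (ℕ × Bool) V := ⟨fun v a => act v (letterValue z a), v, ∅⟩
  have hA (v : V) (w : GroupWord) : A.evalFrom v w = act v (wordValue z w) := by
    induction w generalizing v with
    | nil => simp [hone]
    | cons a w ih => rw [DFA.evalFrom_cons, ih, wordValue_cons, hmul]
  simp only [← hA]
  induction hl : w.length using Nat.strong_induction_on generalizing w with
  | _ l ih =>
    by_cases hle : w.length ≤ Fintype.card V
    · exact ⟨w, hle, rfl⟩
    · obtain ⟨q, a, b, d, rfl, -, hb, ha, hbq, hd⟩ := A.evalFrom_split (le_of_not_ge hle) rfl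
      have hb' : 0 < b.length := List.length_pos_iff.2 hb
      obtain ⟨t, ht, h⟩ := ih (a ++ d).length (by simp at hl ⊢; omega) (a ++ d) rfl
      refine ⟨t, ht, ?_⟩
      rw [h, DFA.evalFrom_of_append, ha, hd]

/-- Schreier's lemma with a bound on the length of the generators. -/
theorem wordValue_mem_closure_short_loops (hone : ∀ v, act v 1 = v)
    (hmul : ∀ v g h, act v (g * h) = act (act v g) h) (v : V) (w : GroupWord)
    (hw : act v (wordValue z w) = v) :
    wordValue z w ∈ Subgroup.closure {g : M | ∃ l : GroupWord,
      l.length ≤ 2 * Fintype.card V + 1 ∧ act v (wordValue z l) = v ∧ wordValue z l = g} := by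
  set S := {g : M | ∃ l : GroupWord,
      l.length ≤ 2 * Fintype.card V + 1 ∧ act v (wordValue z l) = v ∧ wordValue z l = g}
  choose t ht htv using exists_short_word z hone hmul v
  -- `r w` represents the coset of `w`: it depends on the end point of `w` only.
  let r : V → GroupWord := fun p =>
    open Classical in if h : ∃ w, act v (wordValue z w) = p then t h.choose else []
  have hr (w : GroupWord) : (r (act v (wordValue z w))).length ≤ Fintype.card V ∧
      act v (wordValue z (r (act v (wordValue z w)))) = act v (wordValue z w) := by
    have h : ∃ w', act v (wordValue z w') = act v (wordValue z w) := ⟨w, rfl⟩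
    simp only [r, dif_pos h]
    exact ⟨ht _, (htv _).trans h.choose_spec⟩
  have hinv {g h : M} (hgh : act v g = act v h) : act v (g * h⁻¹) = v := by
    rw [hmul, hgh, ← hmul, mul_inv_cancel, hone]
  have hr0 : wordValue z (r v) ∈ Subgroup.closure S := by
    have h := hr []
    rw [wordValue_nil, hone] at h
    exact Subgroup.subset_closure ⟨r v, by omega, h.2, rfl⟩
  have key (w : GroupWord) :
      wordValue z w * (wordValue z (r (act v (wordValue z w))))⁻¹ ∈ Subgroup.closure S := by
    induction w using List.reverseRecOn with
    | nil =>
      rw [wordValue_nil, hone, one_mul]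
      exact inv_mem hr0
    | append_singleton w a ih =>
      obtain ⟨h1, h2⟩ := hr w
      obtain ⟨h3, h4⟩ := hr (w ++ [a])
      set p := r (act v (wordValue z w))
      set p' := r (act v (wordValue z (w ++ [a])))
      have hS : wordValue z (p ++ [a] ++ FreeGroup.invRev p') ∈ Subgroup.closure S := by
        refine Subgroup.subset_closure ⟨p ++ [a] ++ FreeGroup.invRev p', ?_, ?_, rfl⟩
        · simp only [List.length_append, List.length_singleton, FreeGroup.invRev_length]
          omega
        · rw [wordValue_append, wordValue_invRev]
          apply hinv
          rw [h4, wordValue_append, wordValue_append, hmul, h2, ← hmul]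
      have := mul_mem ih hS
      simpa [mul_assoc] using this
  have := mul_mem (key w) hr0
  rwa [hw, inv_mul_cancel_right] at this

end Schreier

/-! ### The reduction to `K` -/

/-- The letters with index below `L`. -/
def lettersBelow (L : ℕ) : GroupWord :=
  (List.range L).flatMap fun i => [(i, true), (i, false)]

/-- The words of length at most `N` in the letters with index below `L`. -/
def wordsUpTo (L : ℕ) : ℕ → List GroupWord
  | 0 => [[]]
  | N + 1 => [] :: (wordsUpTo L N).flatMap fun w => (lettersBelow L).map fun a => a :: w

theorem mem_lettersBelow {L : ℕ} {a : ℕ × Bool} : a ∈ lettersBelow L ↔ a.1 < L := by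
  obtain ⟨i, b⟩ := a
  cases b <;> simp [lettersBelow]

theorem mem_wordsUpTo {L N : ℕ} {w : GroupWord} (hN : w.length ≤ N) (hL : ∀ a ∈ w, a.1 < L) :
    w ∈ wordsUpTo L N := by
  induction w generalizing N with
  | nil => cases N <;> simp [wordsUpTo]
  | cons a w ih =>
    obtain ⟨N, rfl⟩ : ∃ N', N = N' + 1 := Nat.exists_eq_succ_of_ne_zero (by
      rintro rfl
      simp at hN)
    simp only [List.length_cons, Nat.add_le_add_iff_right] at hN
    simp only [List.mem_cons, forall_eq_or_imp] at hL
    simp only [wordsUpTo, List.mem_cons, reduceCtorEq, List.mem_flatMap, List.mem_map, false_or]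
    exact ⟨w, ih hN hL.2, a, mem_lettersBelow.2 hL.1, rfl⟩

/-- A finite table that describes a transducer: the entry at the code of `(q, a)` holds the next
state and the word put out when the letter `a` is read in the state `q`. -/
abbrev TransducerTable : Type := List (ℕ × GroupWord)

namespace TransducerTable

/-- One step of the transducer; letters with index at least `m` are blank. -/
def step (m : ℕ) (T : TransducerTable) (q : ℕ) (a : ℕ × Bool) : ℕ × GroupWord :=
  if a.1 < m then List.getD T (Encodable.encode (q, a)) (q, []) else (q, [])

/-- The final state and the output for an input word. -/
def run (m : ℕ) (T : TransducerTable) (q : ℕ) (w : GroupWord) : ℕ × GroupWord :=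
  w.foldl (fun s a => ((step m T s.1 a).1, s.2 ++ (step m T s.1 a).2)) (q, [])

theorem run_nil (m : ℕ) (T : TransducerTable) (q : ℕ) : run m T q [] = (q, []) := rfl

theorem run_append_singleton (m : ℕ) (T : TransducerTable) (q : ℕ) (w : GroupWord) (a : ℕ × Bool) :
    run m T q (w ++ [a]) = ((step m T (run m T q w).1 a).1,
      (run m T q w).2 ++ (step m T (run m T q w).1 a).2) := by
  simp [run]

/-- The final states and outputs, for both homomorphisms of an instance, on the short words of the
free group. The length suffices for Schreier generators of the stabiliser of a point in a set with
`(n + 1) * (n + 1)` elements. -/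
def shortRuns (m n : ℕ) (T : TransducerTable) (I : HomPairCode) :
    List ((ℕ × GroupWord) × (ℕ × GroupWord)) :=
  (wordsUpTo (List.length I) (2 * ((n + 1) * (n + 1)) + 1)).map fun w =>
    (run m T 0 (substWord (I.map Prod.fst) w), run m T 0 (substWord (I.map Prod.snd) w))

/-- The restriction of an instance to the subgroup of the free group whose elements are mapped into
the stabiliser of the state `0` by both homomorphisms. -/
def loopInstance (m n : ℕ) (T : TransducerTable) (I : HomPairCode) : HomPairCode :=
  ((shortRuns m n T I).filter fun s => s.1.1 = 0 ∧ s.2.1 = 0).map fun s => (s.1.2, s.2.2)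

/-- The instances of the non-homogeneous problem that come from the cosets on which both
homomorphisms lead to the same state, different from `0`. -/
def cosetInstances (m n : ℕ) (T : TransducerTable) (I : HomPairCode) : List NPCPCode :=
  ((shortRuns m n T I).filter fun s => s.1.1 = s.2.1 ∧ s.1.1 ≠ 0).map fun s =>
    (([], []) :: loopInstance m n T I, [], s.1.2, [], s.2.2)

variable {G K : Type*} [Group G] [Group K] {m n k : ℕ}

/-- The table computes the cocycle `c` with respect to generators of `G` and of `K`. -/
def Computes (T : TransducerTable) (y : Fin m → G) (x : Fin k → K) (c : FreeCocycle G K n) :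
    Prop :=
  ∀ (q : Fin (n + 1)) (a : ℕ × Bool), a.1 < m →
    (step m T q a).1 = c.state q (letterValue y a) ∧
      wordValue x (step m T q a).2 = c.label q (letterValue y a)

theorem exists_computes {x : Fin k → K} (hx : Subgroup.closure (Set.range x) = ⊤)
    (y : Fin m → G) (c : FreeCocycle G K n) : ∃ T : TransducerTable, T.Computes y x c := by
  choose u hu using fun g => exists_wordValue_eq hx g
  let F : ℕ × (ℕ × Bool) → ℕ × GroupWord := fun p =>
    (c.state (Fin.ofNat (n + 1) p.1) (letterValue y p.2),
      u (c.label (Fin.ofNat (n + 1) p.1) (letterValue y p.2)))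
  let B : ℕ := ((Finset.range (n + 1)) ×ˢ (Finset.range m ×ˢ (Finset.univ : Finset Bool))).sup
    Encodable.encode
  let T : TransducerTable := (List.range (B + 1)).map fun i =>
    F ((Encodable.decode i).getD (0, (0, true)))
  refine ⟨T, fun q a ha => ?_⟩
  have hB : Encodable.encode ((q : ℕ), a) < B + 1 := Nat.lt_succ_of_le <|
    Finset.le_sup (f := Encodable.encode) (by simp [ha, Fin.is_le q])
  have hstep : step m T q a = F (q, a) := by
    rw [step, if_pos ha, List.getD_eq_getElem _ _ (by simpa [T] using hB)]
    simp only [T, List.getElem_map, List.getElem_range, Encodable.encodek, Option.getD_some]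
  rw [hstep]
  simp [F, hu]

variable {T : TransducerTable} {y : Fin m → G} {x : Fin k → K} {c : FreeCocycle G K n}

theorem Computes.step_eq (hT : T.Computes y x c) (q : Fin (n + 1)) (a : ℕ × Bool) :
    (step m T q a).1 = c.state q (letterValue y a) ∧
      wordValue x (step m T q a).2 = c.label q (letterValue y a) := by
  by_cases ha : a.1 < m
  · exact hT q a ha
  · simp [step, ha, letterValue_of_le y (Nat.not_lt.1 ha), c.state_one, c.label_one]

theorem Computes.run_eq (hT : T.Computes y x c) (q : Fin (n + 1)) (w : GroupWord) :
    (run m T q w).1 = c.state q (wordValue y w) ∧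
      wordValue x (run m T q w).2 = c.label q (wordValue y w) := by
  induction w using List.reverseRecOn with
  | nil => simp [run_nil, c.state_one, c.label_one]
  | append_singleton w a ih =>
    rw [run_append_singleton, ih.1, wordValue_append, wordValue_append, c.state_mul, c.label_mul,
      ih.2, (hT.step_eq _ a).1, (hT.step_eq _ a).2]
    simp

theorem substWord_filter (D : List GroupWord) (w : GroupWord) :
    substWord D (w.filter fun a => a.1 < D.length) = substWord D w := by
  induction w with
  | nil => rfl
  | cons a w ih =>
    obtain ⟨i, b⟩ := a
    by_cases h : i < D.length
    · simp [h, substWord_cons, ih]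
    · simp only [h, decide_false, Bool.false_eq_true, not_false_eq_true, List.filter_cons_of_neg,
        ih, substWord_cons]
      cases b <;> simp [Nat.not_lt.1 h]

end TransducerTable

namespace HomPairCode

variable {G : Type*} [Group G] {m : ℕ}

/-- The pair of the values in `G` of the two images of a word of the free group. -/
def pairValue (y : Fin m → G) (I : HomPairCode) (w : GroupWord) : G × G :=
  (wordValue y (substWord (I.map Prod.fst) w), wordValue y (substWord (I.map Prod.snd) w))

theorem pairValue_eq_wordValue (y : Fin m → G) (I : HomPairCode) (w : GroupWord) :
    pairValue y I w = wordValue (fun i : Fin (List.length I) =>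
      ((wordValue y (I.get i).1, wordValue y (I.get i).2) : G × G)) w := by
  rw [wordValue_prodMk, pairValue, wordValue_substWord, wordValue_substWord]
  congr 1 <;> exact wordValue_congr (by simp) (by simp) w

end HomPairCode

namespace TransducerTable

open HomPairCode

variable {G K : Type*} [Group G] [Group K] {m n k : ℕ} {T : TransducerTable} {y : Fin m → G}
  {x : Fin k → K} {c : FreeCocycle G K n}

theorem mem_shortRuns (I : HomPairCode) (w : GroupWord)
    (hw : w.length ≤ 2 * ((n + 1) * (n + 1)) + 1) :
    (run m T 0 (substWord (I.map Prod.fst) w), run m T 0 (substWord (I.map Prod.snd) w)) ∈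
      shortRuns m n T I := by
  refine List.mem_map.2 ⟨w.filter fun a => a.1 < List.length I,
    mem_wordsUpTo ((List.length_filter_le _ _).trans hw) (by simp), ?_⟩
  have h1 := substWord_filter (I.map Prod.fst) w
  have h2 := substWord_filter (I.map Prod.snd) w
  rw [List.length_map] at h1 h2
  rw [h1, h2]

theorem Computes.run_pairValue (hT : T.Computes y x c) (I : HomPairCode) (w : GroupWord) :
    ((run m T 0 (substWord (I.map Prod.fst) w)).1 = c.state 0 (pairValue y I w).1 ∧
      wordValue x (run m T 0 (substWord (I.map Prod.fst) w)).2 = c.label 0 (pairValue y I w).1) ∧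
    (run m T 0 (substWord (I.map Prod.snd) w)).1 = c.state 0 (pairValue y I w).2 ∧
      wordValue x (run m T 0 (substWord (I.map Prod.snd) w)).2 = c.label 0 (pairValue y I w).2 :=
  ⟨hT.run_eq 0 _, hT.run_eq 0 _⟩

/-- The pairs of values of the restricted instance are the pairs of labels of the words that fix
the state `0` under both homomorphisms. -/
theorem Computes.exists_pairValue_loopInstance_iff (hT : T.Computes y x c) (I : HomPairCode)
    (p : K × K) :
    (∃ v, pairValue x (loopInstance m n T I) v = p) ↔
      ∃ w, c.state 0 (pairValue y I w).1 = 0 ∧ c.state 0 (pairValue y I w).2 = 0 ∧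
        (c.label 0 (pairValue y I w).1, c.label 0 (pairValue y I w).2) = p := by
  set z : Fin (List.length I) → G × G :=
    fun i => (wordValue y (I.get i).1, wordValue y (I.get i).2)
  have hpv (w : GroupWord) : pairValue y I w = wordValue z w := pairValue_eq_wordValue y I w
  simp only [pairValue_eq_wordValue x, ← mem_closure_range_iff, hpv]
  set J := loopInstance m n T I
  have hrange (p : K × K) : (p ∈ Set.range fun i : Fin (List.length J) =>
      ((wordValue x (J.get i).1, wordValue x (J.get i).2) : K × K)) ↔
        ∃ s ∈ J, (wordValue x s.1, wordValue x s.2) = p := by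
    constructor
    · rintro ⟨i, rfl⟩
      exact ⟨_, List.get_mem J i, rfl⟩
    · rintro ⟨s, hs, rfl⟩
      obtain ⟨i, rfl⟩ := List.get_of_mem hs
      exact ⟨i, rfl⟩
  constructor
  · intro hp
    induction hp using Subgroup.closure_induction with
    | mem p hp =>
      obtain ⟨s, hs, rfl⟩ := (hrange p).1 hp
      simp only [J, loopInstance, List.mem_map, List.mem_filter, decide_eq_true_eq,
        shortRuns] at hs
      obtain ⟨_, ⟨⟨w, -, rfl⟩, h1, h2⟩, rfl⟩ := hs
      obtain ⟨⟨h3, h4⟩, h5, h6⟩ := hT.run_pairValue I w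
      rw [h1, hpv] at h3
      rw [h2, hpv] at h5
      rw [hpv] at h4 h6
      exact ⟨w, Fin.ext h3.symm, Fin.ext h5.symm, by rw [h4, h6]⟩
    | one => exact ⟨[], by simp [c.state_one, c.label_one]⟩
    | mul p q _ _ ihp ihq =>
      obtain ⟨v, hv1, hv2, rfl⟩ := ihp
      obtain ⟨w, hw1, hw2, rfl⟩ := ihq
      refine ⟨v ++ w, ?_⟩
      simp [c.state_mul, c.label_mul, hv1, hv2, hw1, hw2]
    | inv p _ ihp =>
      obtain ⟨v, hv1, hv2, rfl⟩ := ihp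
      refine ⟨FreeGroup.invRev v, ?_⟩
      simp [c.state_inv hv1, c.state_inv hv2, c.label_inv hv1, c.label_inv hv2]
  · rintro ⟨w, h1, h2, rfl⟩
    let act : Fin (n + 1) × Fin (n + 1) → G × G → Fin (n + 1) × Fin (n + 1) :=
      fun v g => (c.state v.1 g.1, c.state v.2 g.2)
    have hw := wordValue_mem_closure_short_loops (act := act) z (by simp [act, c.state_one])
      (by simp [act, c.state_mul]) (0, 0) w (by simp [act, h1, h2])
    have key : c.state 0 (wordValue z w).1 = 0 ∧ c.state 0 (wordValue z w).2 = 0 ∧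
        (c.label 0 (wordValue z w).1, c.label 0 (wordValue z w).2) ∈
          Subgroup.closure (Set.range fun i : Fin (List.length J) =>
            ((wordValue x (J.get i).1, wordValue x (J.get i).2) : K × K)) := by
      revert hw
      generalize wordValue z w = g
      intro hw
      induction hw using Subgroup.closure_induction with
      | mem g hg =>
        obtain ⟨l, hl, hact, rfl⟩ := hg
        obtain ⟨ha1, ha2⟩ := Prod.ext_iff.1 hact
        simp only [act] at ha1 ha2
        simp only [Fintype.card_prod, Fintype.card_fin] at hl
        obtain ⟨⟨h3, h4⟩, h5, h6⟩ := hT.run_pairValue I l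
        rw [hpv, ha1] at h3
        rw [hpv, ha2] at h5
        rw [hpv] at h4 h6
        refine ⟨ha1, ha2, Subgroup.subset_closure ((hrange _).2 ⟨(_, _), List.mem_map.2
          ⟨_, List.mem_filter.2 ⟨mem_shortRuns I l hl, ?_⟩, rfl⟩, ?_⟩)⟩
        · simp [h3, h5]
        · simp only [h4, h6]
      | one => simp [c.state_one, c.label_one, ← Prod.one_eq_mk, one_mem]
      | mul g h _ _ ihg ihh =>
        obtain ⟨hg1, hg2, hg3⟩ := ihg
        obtain ⟨hh1, hh2, hh3⟩ := ihh
        simp only [Prod.fst_mul, Prod.snd_mul, c.state_mul, c.label_mul, hg1, hg2, hh1, hh2,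
          true_and]
        exact mul_mem hg3 hh3
      | inv g _ ihg =>
        obtain ⟨hg1, hg2, hg3⟩ := ihg
        simp only [Prod.fst_inv, Prod.snd_inv, c.state_inv hg1, c.state_inv hg2, c.label_inv hg1,
          c.label_inv hg2, true_and]
        exact inv_mem hg3
    exact key.2.2

/-- The kernel-based problem for `G` reduces to one instance of the kernel-based problem and
finitely many instances of the non-homogeneous problem for `K`. -/
theorem Computes.pcpSolvable_iff (hT : T.Computes y x c) (I : HomPairCode) :
    PCPSolvable y I ↔ PCPSolvable x (loopInstance m n T I) ∨
      ∃ J ∈ cosetInstances m n T I, NPCPSolvable x J := by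
  have hmul (v w : GroupWord) : pairValue y I (v ++ w) = pairValue y I v * pairValue y I w := by
    simp [pairValue_eq_wordValue]
  have hinv (v : GroupWord) : pairValue y I (FreeGroup.invRev v) = (pairValue y I v)⁻¹ := by
    simp [pairValue_eq_wordValue]
  rw [_root_.pcpSolvable_iff, _root_.pcpSolvable_iff]
  constructor
  · rintro ⟨w, h, h1⟩
    have heq : (pairValue y I w).1 = (pairValue y I w).2 := h
    have hne : (pairValue y I w).1 ≠ 1 := h1
    by_cases h0 : c.state 0 (pairValue y I w).1 = 0
    · left
      obtain ⟨v, hv⟩ := (hT.exists_pairValue_loopInstance_iff I _).2 ⟨w, h0, heq ▸ h0, rfl⟩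
      obtain ⟨hv1, hv2⟩ := Prod.ext_iff.1 hv
      refine ⟨v, hv1.trans ?_, ?_⟩
      · exact (congrArg (c.label 0) heq).trans hv2.symm
      · intro h
        exact hne (c.eq_one_of_fix _ h0 (hv1.symm.trans h))
    · right
      obtain ⟨t, ht, htv⟩ := exists_short_word
        (act := fun (v : Fin (n + 1) × Fin (n + 1)) (g : G × G) =>
          (c.state v.1 g.1, c.state v.2 g.2))
        (fun i : Fin (List.length I) => ((wordValue y (I.get i).1, wordValue y (I.get i).2) : G × G))
        (by simp [c.state_one]) (by simp [c.state_mul]) (0, 0) w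
      simp only [← pairValue_eq_wordValue, Prod.mk.injEq] at htv
      simp only [Fintype.card_prod, Fintype.card_fin] at ht
      obtain ⟨⟨h3, h4⟩, h5, h6⟩ := hT.run_pairValue I t
      refine ⟨_, List.mem_map.2 ⟨_, List.mem_filter.2 ⟨mem_shortRuns I t (by omega), ?_⟩, rfl⟩, ?_⟩
      · refine decide_eq_true ⟨?_, fun hz => h0 ?_⟩
        · rw [h3, h5, htv.1, htv.2, heq]
        · rw [h3, htv.1] at hz
          exact Fin.ext hz
      · obtain ⟨v, hv⟩ := (hT.exists_pairValue_loopInstance_iff I _).2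
          ⟨w ++ FreeGroup.invRev t, by
            rw [hmul, hinv]
            exact c.state_mul_inv htv.1.symm, by
            rw [hmul, hinv]
            exact c.state_mul_inv htv.2.symm, rfl⟩
        obtain ⟨hv1, hv2⟩ := Prod.ext_iff.1 hv
        refine (npcpSolvable_nil_cons_iff _ _ _ _).2 ⟨v, ?_⟩
        rw [h4, h6]
        change (pairValue x _ v).1 * _ = (pairValue x _ v).2 * _
        rw [hv1, hv2, hmul, hinv]
        simp only [Prod.fst_mul, Prod.fst_inv, Prod.snd_mul, Prod.snd_inv]
        rw [c.label_mul_inv_mul htv.1.symm, c.label_mul_inv_mul htv.2.symm, heq]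
  · rintro (⟨v, h, h1⟩ | ⟨J, hJ, h⟩)
    · obtain ⟨w, hw1, hw2, hw⟩ := (hT.exists_pairValue_loopInstance_iff I _).1 ⟨v, rfl⟩
      obtain ⟨hv1, hv2⟩ := Prod.ext_iff.1 hw
      refine ⟨w, c.eq_of_state_eq_of_label_eq (hw1.trans hw2.symm)
        (hv1.trans (Eq.trans h hv2.symm)), fun hw' => h1 ?_⟩
      have hw'' : (pairValue y I w).1 = 1 := hw'
      rw [hw'', c.label_one] at hv1
      exact hv1.symm
    · simp only [cosetInstances, List.mem_map, List.mem_filter, shortRuns,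
        decide_eq_true_eq] at hJ
      obtain ⟨_, ⟨⟨t, -, rfl⟩, ht, ht0⟩, rfl⟩ := hJ
      obtain ⟨⟨h3, h4⟩, h5, h6⟩ := hT.run_pairValue I t
      obtain ⟨v, hv⟩ := (npcpSolvable_nil_cons_iff _ _ _ _).1 h
      obtain ⟨w, hw1, hw2, hw⟩ := (hT.exists_pairValue_loopInstance_iff I _).1 ⟨v, rfl⟩
      obtain ⟨hv1, hv2⟩ := Prod.ext_iff.1 hw
      simp only [h3, h5] at ht ht0
      have hs : c.state 0 (pairValue y I (w ++ t)).1 = c.state 0 (pairValue y I t).1 := by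
        rw [hmul, Prod.fst_mul, c.state_mul, hw1]
      have hs' : c.state 0 (pairValue y I (w ++ t)).2 = c.state 0 (pairValue y I t).2 := by
        rw [hmul, Prod.snd_mul, c.state_mul, hw2]
      refine ⟨w ++ t, c.eq_of_state_eq_of_label_eq (hs.trans ((Fin.ext ht).trans hs'.symm)) ?_,
        fun h1 => ht0 ?_⟩
      · change c.label 0 (pairValue y I (w ++ t)).1 = c.label 0 (pairValue y I (w ++ t)).2
        rw [hmul, Prod.fst_mul, Prod.snd_mul, c.label_mul, c.label_mul, hw1, hw2]
        simp only at hv1 hv2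
        rw [hv1, hv2, ← h4, ← h6]
        exact hv
      · rw [← hs, show (pairValue y I (w ++ t)).1 = 1 from h1, c.state_one]
        rfl

end TransducerTable

/-! ### Computability of the reduction -/

section Computability

open Primrec

variable {α : Type*} [Primcodable α]

theorem PrimrecPred.filter {β : Type*} [Primcodable β] {p : β → Prop} [DecidablePred p]
    (hp : PrimrecPred p) {f : α → List β} (hf : Primrec f) :
    Primrec fun a => (f a).filter (p ·) :=
  (Primrec.listFilter hp).comp hf

theorem Primrec.lettersBelow : Primrec lettersBelow :=
  list_flatMap list_range
    (list_cons.comp (snd.pair (Primrec.const true))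
      (list_cons.comp (snd.pair (Primrec.const false)) (Primrec.const []))).to₂

theorem Primrec.wordsUpTo : Primrec₂ wordsUpTo := by
  have hstep : Primrec fun p : ℕ × ℕ × List GroupWord =>
      [] :: p.2.2.flatMap fun w => (_root_.lettersBelow p.1).map fun a => a :: w := by
    refine list_cons.comp (Primrec.const []) (list_flatMap (snd.comp snd) ?_)
    exact (list_map (Primrec.lettersBelow.comp (fst.comp fst))
      (list_cons.comp snd (snd.comp fst)).to₂).to₂
  refine (nat_rec (f := fun _ : ℕ => [[]]) (Primrec.const [[]]) hstep.to₂).of_eq fun L N => ?_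
  induction N with
  | zero => rfl
  | succ N ih => exact congrArg (fun l : List GroupWord => [] :: l.flatMap _) ih

namespace TransducerTable

theorem primrec_step {m q : α → ℕ} {T : α → TransducerTable} {a : α → ℕ × Bool}
    (hm : Primrec m) (hT : Primrec T) (hq : Primrec q) (ha : Primrec a) :
    Primrec fun p => step (m p) (T p) (q p) (a p) := by
  have hd : Primrec fun p => (q p, ([] : GroupWord)) := hq.pair (Primrec.const [])
  refine Primrec.ite (nat_lt.comp (fst.comp ha) hm) ?_ hd
  refine (option_getD.comp (list_getElem?.comp hT (Primrec.encode.comp (hq.pair ha))) hd).of_eq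
    fun p => ?_
  rw [List.getD_eq_getElem?_getD]

theorem primrec_run {m q : α → ℕ} {T : α → TransducerTable} {w : α → GroupWord}
    (hm : Primrec m) (hT : Primrec T) (hq : Primrec q) (hw : Primrec w) :
    Primrec fun p => run (m p) (T p) (q p) (w p) := by
  have hs : Primrec fun p : α × (ℕ × GroupWord) × (ℕ × Bool) =>
      step (m p.1) (T p.1) p.2.1.1 p.2.2 :=
    primrec_step (hm.comp fst) (hT.comp fst) (fst.comp (fst.comp snd)) (snd.comp snd)
  exact list_foldl hw (hq.pair (Primrec.const []))
    ((fst.comp hs).pair (list_append.comp (snd.comp (fst.comp snd)) (snd.comp hs))).to₂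

variable {m n : α → ℕ} {T : α → TransducerTable} {I : α → HomPairCode}

theorem primrec_shortRuns (hm : Primrec m) (hn : Primrec n) (hT : Primrec T) (hI : Primrec I) :
    Primrec fun p => shortRuns (m p) (n p) (T p) (I p) := by
  have hn1 : Primrec fun p => n p + 1 := Primrec.succ.comp hn
  have hN : Primrec fun p => 2 * ((n p + 1) * (n p + 1)) + 1 :=
    Primrec.succ.comp (nat_mul.comp (Primrec.const 2) (nat_mul.comp hn1 hn1))
  have hsub {π : GroupWord × GroupWord → GroupWord} (hπ : Primrec π) :
      Primrec fun p : α × GroupWord =>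
        run (m p.1) (T p.1) 0 (substWord ((I p.1).map π) p.2) :=
    primrec_run (hm.comp fst) (hT.comp fst) (Primrec.const 0)
      (Primrec.substWord.comp (list_map (hI.comp fst) (hπ.comp snd).to₂) snd)
  exact list_map (Primrec.wordsUpTo.comp (list_length.comp hI) hN)
    ((hsub fst).pair (hsub snd)).to₂

theorem primrec_loopInstance (hm : Primrec m) (hn : Primrec n) (hT : Primrec T)
    (hI : Primrec I) : Primrec fun p => loopInstance (m p) (n p) (T p) (I p) := by
  have hp : PrimrecPred fun s : (ℕ × GroupWord) × (ℕ × GroupWord) => s.1.1 = 0 ∧ s.2.1 = 0 :=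
    (Primrec.eq.comp (fst.comp fst) (Primrec.const 0)).and
      (Primrec.eq.comp (fst.comp snd) (Primrec.const 0))
  exact list_map (hp.filter (primrec_shortRuns hm hn hT hI))
    ((snd.comp (fst.comp snd)).pair (snd.comp (snd.comp snd))).to₂

theorem primrec_cosetInstances (hm : Primrec m) (hn : Primrec n) (hT : Primrec T)
    (hI : Primrec I) : Primrec fun p => cosetInstances (m p) (n p) (T p) (I p) := by
  have hp : PrimrecPred fun s : (ℕ × GroupWord) × (ℕ × GroupWord) =>
      s.1.1 = s.2.1 ∧ s.1.1 ≠ 0 :=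
    (Primrec.eq.comp (fst.comp fst) (fst.comp snd)).and
      (Primrec.eq.comp (fst.comp fst) (Primrec.const 0)).not
  refine list_map (hp.filter (primrec_shortRuns hm hn hT hI)) (Primrec₂.mk ?_)
  exact (list_cons.comp (Primrec.const ([], []))
    ((primrec_loopInstance hm hn hT hI).comp fst)).pair
    ((Primrec.const []).pair ((snd.comp (fst.comp snd)).pair
      ((Primrec.const []).pair (snd.comp (snd.comp snd)))))

/-- The right-hand side of the reduction `Computes.pcpSolvable_iff` is decidable, uniformly in the
table. -/
theorem computablePred_reduction {K : Type*} [Group K] {k : ℕ} {x : Fin k → K}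
    (hP : ComputablePred fun I : HomPairCode => PCPSolvable x I)
    (hN : ComputablePred fun J : NPCPCode => NPCPSolvable x J) :
    ComputablePred fun p : (ℕ × ℕ × TransducerTable) × HomPairCode =>
      PCPSolvable x (loopInstance p.1.1 p.1.2.1 p.1.2.2 p.2) ∨
        ∃ J ∈ cosetInstances p.1.1 p.1.2.1 p.1.2.2 p.2, NPCPSolvable x J := by
  have h1 : Primrec fun p : (ℕ × ℕ × TransducerTable) × HomPairCode => p.1.1 := fst.comp fst
  have h2 : Primrec fun p : (ℕ × ℕ × TransducerTable) × HomPairCode => p.1.2.1 :=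
    fst.comp (snd.comp fst)
  have h3 : Primrec fun p : (ℕ × ℕ × TransducerTable) × HomPairCode => p.1.2.2 :=
    snd.comp (snd.comp fst)
  exact (hP.comp (primrec_loopInstance h1 h2 h3 snd).to_comp).or
    (hN.exists_mem_list.comp (primrec_cosetInstances h1 h2 h3 snd).to_comp)

end TransducerTable

end Computability

/-- Decidability of both problems for `K` gives decidability of the kernel-based problem for a
single group that contains `K` with finite index. -/
theorem IsVirtually.pcpDecidable {K G : Type*} [Group K] [Group G] (hG : IsVirtually K G)
    (hPCP : PCPDecidable K) (hNPCP : NPCPDecidable K) : PCPDecidable G := by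
  obtain ⟨f, hf, hfin⟩ := hG
  obtain ⟨n, c, τ, hτ⟩ := exists_freeCocycle hf hfin
  obtain ⟨k, x, hx, -⟩ := id hPCP
  let y : Fin (k + (n + 1)) → G := Fin.append (fun j => f (x j)) τ
  have hy : Subgroup.closure (Set.range y) = ⊤ := by
    rw [eq_top_iff]
    intro g _
    have hτ_mem (q : Fin (n + 1)) : τ q ∈ Subgroup.closure (Set.range y) :=
      Subgroup.subset_closure ⟨Fin.natAdd k q, by simp [y]⟩
    have hf_mem (b : K) : f b ∈ Subgroup.closure (Set.range y) := by
      obtain ⟨w, rfl⟩ := exists_wordValue_eq hx b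
      rw [map_wordValue]
      refine Subgroup.closure_mono ?_ ((mem_closure_range_iff _ _).2 ⟨w, rfl⟩)
      rintro _ ⟨j, rfl⟩
      exact ⟨Fin.castAdd (n + 1) j, by simp [y]⟩
    rw [← inv_mul_cancel_left (τ 0) g, hτ]
    exact mul_mem (inv_mem (hτ_mem 0)) (mul_mem (hf_mem _) (hτ_mem _))
  obtain ⟨T, hT⟩ := TransducerTable.exists_computes hx y c
  refine ⟨_, y, hy, ?_⟩
  have hdec := TransducerTable.computablePred_reduction
    (hPCP.computablePred (MulEquiv.refl K) x) (hNPCP.computablePred (MulEquiv.refl K) x)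
  exact (hdec.comp (f := fun I : HomPairCode => ((k + (n + 1), n, T), I))
    ((Computable.const _).pair Computable.id)).of_eq fun I => (hT.pcpSolvable_iff I).symm

/-! ### Certificates for the triviality of words in finitely presented groups -/

section Derivations

/-- Words that represent `1` in the group with generators `0, …, k - 1` and relators `R` for an
obvious reason: relators, their inverses, and words of blank letters. -/
def IsTrivialRelator (k : ℕ) (R : List GroupWord) (r : GroupWord) : Prop :=
  r ∈ R ∨ FreeGroup.invRev r ∈ R ∨ ∀ a ∈ r, k ≤ a.1

/-- The product of the conjugates `u * r * u⁻¹` for the pairs `(u, r)` of a list. -/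
def conjugateProduct (d : List (GroupWord × GroupWord)) : GroupWord :=
  d.flatMap fun p => p.1 ++ p.2 ++ FreeGroup.invRev p.1

/-- The list `d` of pairs `(u, r)` shows that `w` is freely equal to a product of conjugates of
trivial relators. -/
def Derives (k : ℕ) (R : List GroupWord) (d : List (GroupWord × GroupWord)) (w : GroupWord) :
    Prop :=
  (∀ p ∈ d, IsTrivialRelator k R p.2) ∧
    FreeGroup.reduce (conjugateProduct d) = FreeGroup.reduce w

/-- Each word of the list `W` has a derivation in the list `E`. -/
def DerivesAll (k : ℕ) (R : List GroupWord) (E : List (List (GroupWord × GroupWord)))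
    (W : List GroupWord) : Prop :=
  ∀ w ∈ W, ∃ d ∈ E, Derives k R d w

theorem wordValue_eq_lift {G : Type*} [Group G] {k : ℕ} (x : Fin k → G) (w : GroupWord) :
    wordValue x w = FreeGroup.lift (fun i : ℕ => letterValue x (i, true)) (FreeGroup.mk w) := by
  rw [FreeGroup.lift_mk, wordValue]
  congr 1
  refine List.map_congr_left fun a _ => ?_
  obtain ⟨i, _ | _⟩ := a
  · exact letterValue_not x i true
  · rfl

theorem wordValue_gen_of_mem {k : ℕ} {R : List GroupWord} {r : GroupWord} (hr : r ∈ R) :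
    wordValue (FinPresGroup.gen k R) r = 1 := by
  have h : PresentedGroup.mk (relatorSet k R) (wordValue (fun i : Fin k => FreeGroup.of i) r) = 1 :=
    (QuotientGroup.eq_one_iff _).2 (Subgroup.subset_normalClosure ⟨r, hr, rfl⟩)
  rwa [map_wordValue] at h

theorem wordValue_gen_of_isTrivialRelator {k : ℕ} {R : List GroupWord} {r : GroupWord}
    (hr : IsTrivialRelator k R r) : wordValue (FinPresGroup.gen k R) r = 1 := by
  rcases hr with hr | hr | hr
  · exact wordValue_gen_of_mem hr
  · simpa using wordValue_gen_of_mem hr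
  · induction r with
    | nil => rfl
    | cons a r ih =>
      simp only [List.mem_cons, forall_eq_or_imp] at hr
      rw [wordValue_cons, letterValue_of_le _ hr.1, ih hr.2, one_mul]

theorem Derives.wordValue_eq_one {k : ℕ} {R : List GroupWord}
    {d : List (GroupWord × GroupWord)} {w : GroupWord} (h : Derives k R d w) :
    wordValue (FinPresGroup.gen k R) w = 1 := by
  rw [wordValue_eq_lift, ← FreeGroup.reduce.exact h.2, ← wordValue_eq_lift]
  have h1 := h.1
  clear h
  induction d with
  | nil => rfl
  | cons p d ih =>
    simp only [List.mem_cons, forall_eq_or_imp] at h1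
    have hc : conjugateProduct (p :: d) =
      (p.1 ++ p.2 ++ FreeGroup.invRev p.1) ++ conjugateProduct d := rfl
    rw [hc, wordValue_append, ih h1.2]
    simp [wordValue_gen_of_isTrivialRelator h1.1]

theorem IsTrivialRelator.invRev {k : ℕ} {R : List GroupWord} {r : GroupWord}
    (hr : IsTrivialRelator k R r) : IsTrivialRelator k R (FreeGroup.invRev r) := by
  rcases hr with hr | hr | hr
  · exact Or.inr (Or.inl (by rwa [FreeGroup.invRev_invRev]))
  · exact Or.inl hr
  · refine Or.inr (Or.inr fun a ha => ?_)
    simp only [FreeGroup.invRev, List.mem_reverse, List.mem_map] at ha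
    obtain ⟨b, hb, rfl⟩ := ha
    exact hr b hb

theorem mk_conjugateProduct (d : List (GroupWord × GroupWord)) :
    FreeGroup.mk (conjugateProduct d) =
      (d.map fun p => FreeGroup.mk p.1 * FreeGroup.mk p.2 * (FreeGroup.mk p.1)⁻¹).prod := by
  induction d with
  | nil => rfl
  | cons p d ih =>
    have hc : conjugateProduct (p :: d) =
      (p.1 ++ p.2 ++ FreeGroup.invRev p.1) ++ conjugateProduct d := rfl
    rw [hc, List.map_cons, List.prod_cons, ← ih, ← FreeGroup.mul_mk, ← FreeGroup.mul_mk,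
      ← FreeGroup.mul_mk, FreeGroup.inv_mk]

/-- Every word that represents `1` has a derivation: the group is the quotient of the free group on
all letters by the normal closure of the trivial relators. -/
theorem exists_derives {k : ℕ} {R : List GroupWord} {w : GroupWord}
    (hw : wordValue (FinPresGroup.gen k R) w = 1) : ∃ d, Derives k R d w := by
  let S : Set (FreeGroup ℕ) := {g | ∃ r, IsTrivialRelator k R r ∧ FreeGroup.mk r = g}
  let π := QuotientGroup.mk' (Subgroup.normalClosure S)
  have hπ {r : GroupWord} (hr : IsTrivialRelator k R r) : π (FreeGroup.mk r) = 1 :=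
    (QuotientGroup.eq_one_iff _).2 (Subgroup.subset_normalClosure ⟨r, hr, rfl⟩)
  let ρ : Fin k → FreeGroup ℕ ⧸ Subgroup.normalClosure S := fun i => π (FreeGroup.of (i : ℕ))
  have hρ (w : GroupWord) : wordValue ρ w = π (FreeGroup.mk w) := by
    have : (FreeGroup.lift fun i : ℕ => letterValue ρ (i, true)) = π := by
      ext i
      rw [FreeGroup.lift_apply_of]
      by_cases hi : i < k
      · simp [letterValue, hi, ρ]
      · rw [letterValue_of_le _ (Nat.not_lt.1 hi)]
        exact (hπ (r := [(i, true)]) (Or.inr (Or.inr (by simpa using hi)))).symm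
    rw [wordValue_eq_lift, this]
  let φ : FinPresGroup k R →* FreeGroup ℕ ⧸ Subgroup.normalClosure S :=
    PresentedGroup.toGroup (f := ρ) (by
      rintro _ ⟨r, hr, rfl⟩
      rw [lift_wordValue_of, hρ]
      exact hπ (Or.inl hr))
  have hφ : φ (wordValue (FinPresGroup.gen k R) w) = π (FreeGroup.mk w) := by
    rw [map_wordValue, ← hρ]
    congr 1
  rw [hw, map_one] at hφ
  have hmem : FreeGroup.mk w ∈ Subgroup.normalClosure S := (QuotientGroup.eq_one_iff _).1 hφ.symm
  have key : ∀ g ∈ Subgroup.normalClosure S, ∃ d : List (GroupWord × GroupWord),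
      (∀ p ∈ d, IsTrivialRelator k R p.2) ∧ FreeGroup.mk (conjugateProduct d) = g := by
    intro g hg
    induction hg using Subgroup.closure_induction with
    | mem g hg =>
      obtain ⟨_, ⟨r, hr, rfl⟩, hc⟩ := Group.mem_conjugatesOfSet_iff.1 hg
      obtain ⟨u, rfl⟩ := isConj_iff.1 hc
      refine ⟨[(u.toWord, r)], by simpa using hr, ?_⟩
      rw [mk_conjugateProduct]
      simp only [List.map_cons, List.map_nil, List.prod_cons, List.prod_nil, mul_one,
        FreeGroup.mk_toWord]
    | one => exact ⟨[], by simp, rfl⟩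
    | mul g h _ _ ihg ihh =>
      obtain ⟨d, hd, rfl⟩ := ihg
      obtain ⟨e, he, rfl⟩ := ihh
      refine ⟨d ++ e, fun p hp => (List.mem_append.1 hp).elim (hd p) (he p), ?_⟩
      simp only [mk_conjugateProduct, List.map_append, List.prod_append]
    | inv g _ ih =>
      obtain ⟨d, hd, rfl⟩ := ih
      refine ⟨(d.map fun p => (p.1, FreeGroup.invRev p.2)).reverse, ?_, ?_⟩
      · intro p hp
        rw [List.mem_reverse, List.mem_map] at hp
        obtain ⟨q, hq, rfl⟩ := hp
        exact (hd q hq).invRev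
      · rw [mk_conjugateProduct, mk_conjugateProduct, List.prod_inv_reverse, List.map_reverse,
          List.map_map, List.map_map]
        congr 2
        refine List.map_congr_left fun p _ => ?_
        simp only [Function.comp_apply, ← FreeGroup.inv_mk]
        group
  obtain ⟨d, hd, h⟩ := key _ hmem
  exact ⟨d, hd, FreeGroup.reduce.sound h⟩

theorem exists_derivesAll {k : ℕ} {R W : List GroupWord}
    (hW : ∀ w ∈ W, wordValue (FinPresGroup.gen k R) w = 1) : ∃ E, DerivesAll k R E W := by
  choose d hd using fun w : {w // w ∈ W} => exists_derives (hW w.1 w.2)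
  exact ⟨W.attach.map d, fun w hw => ⟨d ⟨w, hw⟩,
    List.mem_map.2 ⟨⟨w, hw⟩, List.mem_attach _ _, rfl⟩, hd _⟩⟩

theorem DerivesAll.wordValue_eq_one {k : ℕ} {R W : List GroupWord}
    {E : List (List (GroupWord × GroupWord))} (h : DerivesAll k R E W) {w : GroupWord}
    (hw : w ∈ W) : wordValue (FinPresGroup.gen k R) w = 1 := by
  obtain ⟨d, -, hd⟩ := h w hw
  exact hd.wordValue_eq_one

end Derivations

section Computability

open Primrec

theorem Primrec.reduce : Primrec (FreeGroup.reduce : GroupWord → GroupWord) := by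
  have hc : PrimrecPred fun p : (ℕ × Bool) × (ℕ × Bool) => p.1.1 = p.2.1 ∧ p.1.2 = !p.2.2 :=
    (Primrec.eq.comp (fst.comp fst) (fst.comp snd)).and
      (Primrec.eq.comp (snd.comp fst) (Primrec.not.comp (snd.comp snd)))
  have hstep : Primrec fun p : (ℕ × Bool) × GroupWord =>
      (List.casesOn p.2 [p.1] fun hd tl =>
        if p.1.1 = hd.1 ∧ p.1.2 = !hd.2 then tl else p.1 :: hd :: tl : GroupWord) := by
    refine list_casesOn (f := fun p : (ℕ × Bool) × GroupWord => p.2)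
      (g := fun p => ([p.1] : GroupWord))
      (h := fun p q => if p.1.1 = q.1.1 ∧ p.1.2 = !q.1.2 then q.2 else p.1 :: q.1 :: q.2)
      snd (list_cons.comp fst (Primrec.const [])) (Primrec₂.mk ?_)
    exact Primrec.ite (hc.comp ((fst.comp fst).pair (fst.comp snd))) (snd.comp snd)
      (list_cons.comp (fst.comp fst) (list_cons.comp (fst.comp snd) (snd.comp snd)))
  refine (list_foldr (f := fun w : GroupWord => w) (g := fun _ => ([] : GroupWord))
    Primrec.id (Primrec.const []) (hstep.comp snd).to₂).of_eq fun w => ?_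
  induction w with
  | nil => rfl
  | cons a w ih =>
    rw [FreeGroup.reduce.cons, ← ih]
    rfl

theorem primrecPred_derivesAll {α : Type*} [Primcodable α] {k : α → ℕ}
    {R W : α → List GroupWord} {E : α → List (List (GroupWord × GroupWord))}
    (hk : Primrec k) (hR : Primrec R) (hE : Primrec E) (hW : Primrec W) :
    PrimrecPred fun a => DerivesAll (k a) (R a) (E a) (W a) := by
  have hmem : PrimrecRel fun (L : List GroupWord) (r : GroupWord) => r ∈ L :=
    (PrimrecRel.exists_mem_list Primrec.eq).of_eq fun L r => by simp
  have hblank : PrimrecRel fun (r : GroupWord) (k : ℕ) => ∀ a ∈ r, k ≤ a.1 :=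
    PrimrecRel.forall_mem_list (R := fun (a : ℕ × Bool) (k : ℕ) => k ≤ a.1)
      (nat_le.comp snd (fst.comp fst))
  have hrel : PrimrecRel fun (p : GroupWord × GroupWord) (c : ℕ × List GroupWord) =>
      IsTrivialRelator c.1 c.2 p.2 :=
    (hmem.comp (snd.comp snd) (snd.comp fst)).or
      ((hmem.comp (snd.comp snd) (Primrec.invRev.comp (snd.comp fst))).or
        (hblank.comp (snd.comp fst) (fst.comp snd)))
  have hprod : Primrec conjugateProduct :=
    list_flatMap Primrec.id (list_append.comp (list_append.comp (fst.comp snd) (snd.comp snd))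
      (Primrec.invRev.comp (fst.comp snd))).to₂
  have hder : PrimrecRel fun (d : List (GroupWord × GroupWord))
      (c : (ℕ × List GroupWord) × GroupWord) => Derives c.1.1 c.1.2 d c.2 :=
    (hrel.forall_mem_list.comp fst (fst.comp snd)).and
      (Primrec.eq.comp (Primrec.reduce.comp (hprod.comp fst))
        (Primrec.reduce.comp (snd.comp snd)))
  have hex : PrimrecRel fun (w : GroupWord)
      (c : (ℕ × List GroupWord) × List (List (GroupWord × GroupWord))) =>
      ∃ d ∈ c.2, Derives c.1.1 c.1.2 d w :=
    hder.exists_mem_list.comp (snd.comp snd) ((fst.comp snd).pair fst)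
  exact hex.forall_mem_list.comp hW ((hk.pair hR).pair hE)

end Computability

/-! ### Certificates for finite-index copies of `K` -/

/-- Codes of certificates, as tuples `(n, T, t, F, E₁, E₂)`. The table `T` is a transducer with
states `0, …, n` for the right action of the overgroup on the cosets of a copy of the base group,
`t` lists words for the representatives of the cosets, `F` lists words for the images of the
generators of the base group, and `E₁`, `E₂` are lists of derivations in the overgroup and in the
base group. -/
abbrev CosetCertificate : Type :=
  ℕ × TransducerTable × List GroupWord × List GroupWord ×
    List (List (GroupWord × GroupWord)) × List (List (GroupWord × GroupWord))

namespace CosetCertificate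

open TransducerTable

/-- The list of all `((q, a), step q a)` for states `q ≤ n` and letters `a` with index below `m`. -/
def transitions (m n : ℕ) (T : TransducerTable) : List ((ℕ × (ℕ × Bool)) × (ℕ × GroupWord)) :=
  (List.range (n + 1)).flatMap fun q => (lettersBelow m).map fun a => ((q, a), step m T q a)

/-- The relators together with the words `a * a⁻¹`: the relators of a group as a quotient of the
free monoid on the letters. -/
def monoidRelators (m : ℕ) (R : List GroupWord) : List GroupWord :=
  R ++ (lettersBelow m).map fun a => [a, (a.1, !a.2)]

/-- The list of all `(q, run q r)` for states `q ≤ n` and relators `r`. -/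
def relatorRuns (m n : ℕ) (T : TransducerTable) (R : List GroupWord) :
    List (ℕ × (ℕ × GroupWord)) :=
  (List.range (n + 1)).flatMap fun q => (monoidRelators m R).map fun r => (q, run m T q r)

/-- The word `t_q * a * t_s⁻¹ * F(u)⁻¹` that expresses the rule `t_q * a = F(u) * t_s` for a
transition from `q` to `s` with output `u`. -/
def transitionWord (t F : List GroupWord) (e : (ℕ × (ℕ × Bool)) × (ℕ × GroupWord)) : GroupWord :=
  t.getD e.1.1 [] ++ [e.1.2] ++ FreeGroup.invRev (t.getD e.2.1 []) ++
    FreeGroup.invRev (substWord F e.2.2)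

/-- The words that have to represent `1` in the overgroup: the images of the relators `R₀` of the
base group and the words of the transitions. -/
def overgroupWords (m n : ℕ) (T : TransducerTable) (t F R₀ : List GroupWord) : List GroupWord :=
  R₀.map (substWord F) ++ (transitions m n T).map (transitionWord t F)

/-- The certificate is correct for the overgroup with `m` generators and relators `R` and the base
group with `k₀` generators and relators `R₀`. All conditions can be checked mechanically. -/
def IsValid (k₀ : ℕ) (R₀ : List GroupWord) (m : ℕ) (R : List GroupWord)
    (e : CosetCertificate) : Prop :=
  (∀ s ∈ transitions m e.1 e.2.1, s.2.1 ≤ e.1) ∧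
  (∀ s ∈ relatorRuns m e.1 e.2.1 R, s.2.1 = s.1) ∧
  e.2.2.2.1.length = k₀ ∧
  DerivesAll m R e.2.2.2.2.1 (overgroupWords m e.1 e.2.1 e.2.2.1 e.2.2.2.1 R₀) ∧
  DerivesAll k₀ R₀ e.2.2.2.2.2 ((relatorRuns m e.1 e.2.1 R).map fun s => s.2.2)

theorem mem_transitions {m n : ℕ} {T : TransducerTable}
    {e : (ℕ × (ℕ × Bool)) × (ℕ × GroupWord)} :
    e ∈ transitions m n T ↔ ∃ q ≤ n, ∃ a : ℕ × Bool, a.1 < m ∧ ((q, a), step m T q a) = e := by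
  simp only [transitions, List.mem_flatMap, List.mem_range, Nat.lt_succ_iff, List.mem_map,
    mem_lettersBelow]

theorem mem_relatorRuns {m n : ℕ} {T : TransducerTable} {R : List GroupWord}
    {e : ℕ × (ℕ × GroupWord)} :
    e ∈ relatorRuns m n T R ↔ ∃ q ≤ n, ∃ r ∈ monoidRelators m R, (q, run m T q r) = e := by
  simp only [relatorRuns, List.mem_flatMap, List.mem_range, Nat.lt_succ_iff, List.mem_map]

section Soundness

variable {m n k : ℕ} {T : TransducerTable} {R : List GroupWord} {K : Type*} [Group K]

/-- The transformation of `Fin (n + 1) × K` given by a word: the run of the transducer on it. -/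
def wordAction (m n : ℕ) (T : TransducerTable) (x : Fin k → K) (w : GroupWord)
    (p : Fin (n + 1) × K) : Fin (n + 1) × K :=
  (Fin.ofNat (n + 1) (run m T p.1 w).1, p.2 * wordValue x (run m T p.1 w).2)

theorem step_le (hT : ∀ s ∈ transitions m n T, s.2.1 ≤ n) {q : ℕ} (hq : q ≤ n)
    (a : ℕ × Bool) : (step m T q a).1 ≤ n := by
  by_cases ha : a.1 < m
  · exact hT _ (mem_transitions.2 ⟨q, hq, a, ha, rfl⟩)
  · simpa [step, ha] using hq

theorem run_le (hT : ∀ s ∈ transitions m n T, s.2.1 ≤ n) {q : ℕ} (hq : q ≤ n)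
    (w : GroupWord) : (run m T q w).1 ≤ n := by
  induction w using List.reverseRecOn with
  | nil => exact hq
  | append_singleton w a ih =>
    rw [run_append_singleton]
    exact step_le hT ih a

theorem wordAction_nil (x : Fin k → K) (p : Fin (n + 1) × K) :
    wordAction m n T x [] p = p := by
  simp [wordAction, run_nil]

theorem wordAction_append_singleton (hT : ∀ s ∈ transitions m n T, s.2.1 ≤ n) (x : Fin k → K)
    (w : GroupWord) (a : ℕ × Bool) (p : Fin (n + 1) × K) :
    wordAction m n T x (w ++ [a]) p = wordAction m n T x [a] (wordAction m n T x w p) := by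
  have h1 : ((Fin.ofNat (n + 1) (run m T p.1 w).1 : Fin (n + 1)) : ℕ) = (run m T p.1 w).1 :=
    Nat.mod_eq_of_lt (Nat.lt_succ_of_le (run_le hT (Fin.is_le p.1) w))
  have h2 (q : ℕ) : run m T q [a] = step m T q a := by
    rw [← List.nil_append [a], run_append_singleton, run_nil]
    rfl
  simp only [wordAction, h1, h2, run_append_singleton, wordValue_append, mul_assoc]

theorem wordAction_append (hT : ∀ s ∈ transitions m n T, s.2.1 ≤ n) (x : Fin k → K)
    (v w : GroupWord) (p : Fin (n + 1) × K) :
    wordAction m n T x (v ++ w) p = wordAction m n T x w (wordAction m n T x v p) := by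
  induction w using List.reverseRecOn with
  | nil => rw [List.append_nil, wordAction_nil]
  | append_singleton w a ih =>
    rw [← List.append_assoc, wordAction_append_singleton hT, ih, ← wordAction_append_singleton hT]

theorem wordAction_eq_self {x : Fin k → K} (hR : ∀ s ∈ relatorRuns m n T R, s.2.1 = s.1)
    (hx : ∀ s ∈ relatorRuns m n T R, wordValue x s.2.2 = 1) {r : GroupWord}
    (hr : r ∈ monoidRelators m R) (p : Fin (n + 1) × K) : wordAction m n T x r p = p := by
  have hmem := (mem_relatorRuns (T := T)).2 ⟨(p.1 : ℕ), Fin.is_le p.1, r, hr, rfl⟩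
  have h1 : (run m T p.1 r).1 = p.1 := hR _ hmem
  have h2 : wordValue x (run m T p.1 r).2 = 1 := hx _ hmem
  ext <;> simp [wordAction, h1, h2]

theorem wordAction_cancel (hT : ∀ s ∈ transitions m n T, s.2.1 ≤ n) {x : Fin k → K}
    (hR : ∀ s ∈ relatorRuns m n T R, s.2.1 = s.1)
    (hx : ∀ s ∈ relatorRuns m n T R, wordValue x s.2.2 = 1) (i : ℕ) (b : Bool)
    (p : Fin (n + 1) × K) :
    wordAction m n T x [(i, !b)] (wordAction m n T x [(i, b)] p) = p := by
  rw [← wordAction_append_singleton hT]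
  by_cases hi : i < m
  · refine wordAction_eq_self hR hx (List.mem_append_right _ (List.mem_map.2 ?_)) p
    exact ⟨(i, b), mem_lettersBelow.2 hi, rfl⟩
  · have (b : Bool) : wordAction m n T x [(i, b)] p = p := by
      ext <;> simp [wordAction, run, step, hi]
    rw [wordAction_append_singleton hT, this, this]

/-- A table on whose runs the relators have no effect defines an action of the presented group. -/
theorem exists_hom_perm (hT : ∀ s ∈ transitions m n T, s.2.1 ≤ n) {x : Fin k → K}
    (hR : ∀ s ∈ relatorRuns m n T R, s.2.1 = s.1)
    (hx : ∀ s ∈ relatorRuns m n T R, wordValue x s.2.2 = 1) :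
    ∃ Φ : FinPresGroup m R →* Equiv.Perm (Fin (n + 1) × K), ∀ w p,
      (Φ (wordValue (FinPresGroup.gen m R) w))⁻¹ p = wordAction m n T x w p := by
  -- Words act on the right, so that the letters have to act by inverses.
  let ρ : Fin m → Equiv.Perm (Fin (n + 1) × K) := fun i =>
    { toFun := wordAction m n T x [((i : ℕ), false)]
      invFun := wordAction m n T x [((i : ℕ), true)]
      left_inv := wordAction_cancel hT hR hx i false
      right_inv := wordAction_cancel hT hR hx i true }
  have hletter (a : ℕ × Bool) (p : Fin (n + 1) × K) :
      (letterValue ρ a)⁻¹ p = wordAction m n T x [a] p := by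
    obtain ⟨i, b⟩ := a
    by_cases hi : i < m
    · cases b <;> simp only [letterValue, hi] <;> rfl
    · rw [letterValue_of_le _ (Nat.not_lt.1 hi)]
      ext <;> simp [wordAction, run, step, hi]
  have hρ (w : GroupWord) (p : Fin (n + 1) × K) :
      (wordValue ρ w)⁻¹ p = wordAction m n T x w p := by
    induction w using List.reverseRecOn with
    | nil => simp [wordAction_nil]
    | append_singleton w a ih =>
      rw [wordAction_append_singleton hT, ← ih, ← hletter, wordValue_append]
      simp
  refine ⟨PresentedGroup.toGroup (f := ρ) ?_, fun w p => ?_⟩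
  · rintro _ ⟨r, hr, rfl⟩
    rw [lift_wordValue_of, ← inv_eq_one]
    ext1 p
    rw [hρ, wordAction_eq_self hR hx (List.mem_append_left _ hr)]
    rfl
  · rw [map_wordValue, ← hρ]
    congr 3

/-- A valid certificate yields a free cocycle that its table computes. -/
theorem IsValid.exists_freeCocycle {k₀ : ℕ} {R₀ : List GroupWord} {e : CosetCertificate}
    (he : IsValid k₀ R₀ m R e) :
    ∃ c : FreeCocycle (FinPresGroup m R) (FinPresGroup k₀ R₀) e.1,
      e.2.1.Computes (FinPresGroup.gen m R) (FinPresGroup.gen k₀ R₀) c := by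
  obtain ⟨n, T, t, F, E₁, E₂⟩ := e
  obtain ⟨hT, hR, hF, h₁, h₂⟩ := he
  simp only at hT hR hF h₁ h₂
  obtain ⟨Φ, hΦ⟩ := exists_hom_perm (x := FinPresGroup.gen k₀ R₀) hT hR
    fun s hs => h₂.wordValue_eq_one (List.mem_map.2 ⟨s, hs, rfl⟩)
  set x := FinPresGroup.gen k₀ R₀
  set y := FinPresGroup.gen m R
  have hy (g : FinPresGroup m R) : ∃ w, wordValue y w = g :=
    exists_wordValue_eq (PresentedGroup.closure_range_of _) g
  have hrels : ∀ r ∈ relatorSet k₀ R₀,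
      FreeGroup.lift (fun i : Fin k₀ => wordValue y (F.getD i [])) r = 1 := by
    rintro _ ⟨r, hr, rfl⟩
    rw [lift_wordValue_of, ← h₁.wordValue_eq_one (List.mem_append_left _
      (List.mem_map.2 ⟨r, hr, rfl⟩)), wordValue_substWord]
    exact wordValue_congr hF.symm (by intro i h1 h2; simp [h2, y]) r
  let f : FinPresGroup k₀ R₀ →* FinPresGroup m R := PresentedGroup.toGroup hrels
  have hf (w : GroupWord) : wordValue y (substWord F w) = f (wordValue x w) := by
    rw [wordValue_substWord, map_wordValue]
    refine wordValue_congr hF (fun i h1 h2 => ?_) w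
    refine Eq.trans ?_ (PresentedGroup.toGroup.of _).symm
    simp [h1]
  -- The map `(q, b) ↦ f b * t_q` to the overgroup is equivariant, so that the action is free.
  have hrun (q : ℕ) (hq : q ≤ n) (w : GroupWord) : wordValue y (t.getD q []) * wordValue y w =
      f (wordValue x (run m T q w).2) * wordValue y (t.getD (run m T q w).1 []) := by
    induction w using List.reverseRecOn with
    | nil => simp [run_nil]
    | append_singleton w a ih =>
      have hs := run_le hT hq w
      rw [run_append_singleton, wordValue_append, ← mul_assoc, ih, wordValue_append, map_mul,
        mul_assoc, mul_assoc, mul_right_inj]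
      by_cases ha : a.1 < m
      · have hstep := h₁.wordValue_eq_one (List.mem_append_right _ (List.mem_map.2
          ⟨_, mem_transitions.2 ⟨_, hs, a, ha, rfl⟩, rfl⟩))
        simp only [transitionWord, wordValue_append, wordValue_invRev] at hstep
        rw [mul_inv_eq_one, mul_inv_eq_iff_eq_mul] at hstep
        rw [← hf]
        exact hstep
      · simp [step, ha, letterValue_of_le y (Nat.not_lt.1 ha)]
  let c : FreeCocycle (FinPresGroup m R) (FinPresGroup k₀ R₀) n :=
    { state := fun q g => ((Φ g)⁻¹ (q, 1)).1
      label := fun q g => ((Φ g)⁻¹ (q, 1)).2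
      state_one := fun q => by simp
      state_mul := fun q g h => by
        obtain ⟨v, rfl⟩ := hy g
        obtain ⟨w, rfl⟩ := hy h
        rw [← wordValue_append, hΦ, hΦ, hΦ, wordAction_append hT]
        rfl
      label_mul := fun q g h => by
        obtain ⟨v, rfl⟩ := hy g
        obtain ⟨w, rfl⟩ := hy h
        rw [← wordValue_append, hΦ, hΦ, hΦ, wordAction_append hT]
        simp [wordAction]
      eq_one_of_fix := fun g hs hl => by
        obtain ⟨w, rfl⟩ := hy g
        rw [hΦ] at hs hl
        have h0 : (run m T 0 w).1 = 0 := by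
          have hlt := Nat.lt_succ_of_le (run_le hT (Nat.zero_le n) w)
          simpa [wordAction, Fin.ext_iff, Nat.mod_eq_of_lt hlt] using hs
        have h1 : wordValue x (run m T 0 w).2 = 1 := by simpa [wordAction] using hl
        simpa [h0, h1] using hrun 0 (Nat.zero_le n) w }
  refine ⟨c, fun q a _ => ?_⟩
  have hs : run m T q [a] = step m T q a := by
    rw [← List.nil_append [a], run_append_singleton, run_nil]
    rfl
  have hlt := Nat.lt_succ_of_le (step_le hT (Fin.is_le q) a)
  have ha : letterValue y a = wordValue y [a] := by simp
  constructor
  · change _ = ((((Φ (letterValue y a))⁻¹ (q, 1)).1 : Fin (n + 1)) : ℕ)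
    rw [ha, hΦ]
    simp [wordAction, hs, Nat.mod_eq_of_lt hlt]
  · change _ = ((Φ (letterValue y a))⁻¹ (q, 1)).2
    rw [ha, hΦ]
    simp [wordAction, hs]

end Soundness

/-- A finite-index embedding has a valid certificate. -/
theorem exists_isValid {k₀ m : ℕ} {R₀ R : List GroupWord}
    (h : IsVirtually (FinPresGroup k₀ R₀) (FinPresGroup m R)) :
    ∃ e, IsValid k₀ R₀ m R e := by
  obtain ⟨f, hf, hfin⟩ := h
  obtain ⟨n, c, τ, hτ⟩ := exists_freeCocycle hf hfin
  set x := FinPresGroup.gen k₀ R₀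
  set y := FinPresGroup.gen m R
  have hx : Subgroup.closure (Set.range x) = ⊤ := PresentedGroup.closure_range_of _
  have hy : Subgroup.closure (Set.range y) = ⊤ := PresentedGroup.closure_range_of _
  obtain ⟨T, hT⟩ := exists_computes hx y c
  choose u hu using exists_wordValue_eq hy
  let t : List GroupWord := List.ofFn fun q => u (τ q)
  let F : List GroupWord := List.ofFn fun i => u (f (x i))
  have ht (q : Fin (n + 1)) : wordValue y (t.getD q []) = τ q := by
    rw [List.getD_eq_getElem _ _ (by simp [t, Fin.is_le q])]
    simp only [t, List.getElem_ofFn, Fin.eta, hu]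
  have hF (w : GroupWord) : wordValue y (substWord F w) = f (wordValue x w) := by
    rw [wordValue_substWord, map_wordValue]
    exact wordValue_congr (by simp [F]) (by intro i h1 h2; simp [F, hu]) w
  have hrel {r : GroupWord} (hr : r ∈ monoidRelators m R) : wordValue y r = 1 := by
    rcases List.mem_append.1 hr with hr | hr
    · exact wordValue_gen_of_mem hr
    · obtain ⟨⟨i, b⟩, -, rfl⟩ := List.mem_map.1 hr
      simp [letterValue_not]
  obtain ⟨E₁, hE₁⟩ := exists_derivesAll (k := m) (R := R) (W := overgroupWords m n T t F R₀) (by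
    intro w hw
    rcases List.mem_append.1 hw with hw | hw
    · obtain ⟨r, hr, rfl⟩ := List.mem_map.1 hw
      exact (hF r).trans (by rw [wordValue_gen_of_mem hr, map_one])
    · obtain ⟨_, he, rfl⟩ := List.mem_map.1 hw
      obtain ⟨q, hq, a, ha, rfl⟩ := mem_transitions.1 he
      obtain ⟨q, rfl⟩ : ∃ q' : Fin (n + 1), (q' : ℕ) = q := ⟨⟨q, Nat.lt_succ_of_le hq⟩, rfl⟩
      obtain ⟨h1, h2⟩ := hT q a ha
      simp only [transitionWord, wordValue_append]
      change wordValue y _ * wordValue y _ * wordValue y _ * wordValue y _ = 1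
      rw [wordValue_invRev, wordValue_invRev, hF, h1, h2, ht, ht, mul_inv_eq_one,
        mul_inv_eq_iff_eq_mul, wordValue_cons, wordValue_nil, mul_one, hτ])
  obtain ⟨E₂, hE₂⟩ := exists_derivesAll (k := k₀) (R := R₀)
    (W := (relatorRuns m n T R).map fun s => s.2.2) (by
      intro w hw
      obtain ⟨_, he, rfl⟩ := List.mem_map.1 hw
      obtain ⟨q, hq, r, hr, rfl⟩ := mem_relatorRuns.1 he
      exact ((hT.run_eq ⟨q, Nat.lt_succ_of_le hq⟩ r).2).trans (by rw [hrel hr, c.label_one]))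
  refine ⟨(n, T, t, F, E₁, E₂), ?_, ?_, by simp [F], hE₁, hE₂⟩
  · intro s hs
    obtain ⟨q, hq, a, ha, rfl⟩ := mem_transitions.1 hs
    rw [(hT ⟨q, Nat.lt_succ_of_le hq⟩ a ha).1]
    exact Fin.is_le _
  · intro s hs
    obtain ⟨q, hq, r, hr, rfl⟩ := mem_relatorRuns.1 hs
    refine ((hT.run_eq ⟨q, Nat.lt_succ_of_le hq⟩ r).1).trans ?_
    rw [hrel hr, c.state_one]

end CosetCertificate

/-! ### The search for a certificate -/

section Search

open Primrec TransducerTable CosetCertificate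

namespace CosetCertificate

variable {α : Type*} [Primcodable α] {m n : α → ℕ} {T : α → TransducerTable}
  {R t F : α → List GroupWord}

theorem primrec_transitions (hm : Primrec m) (hn : Primrec n) (hT : Primrec T) :
    Primrec fun p => transitions (m p) (n p) (T p) := by
  refine list_flatMap (list_range.comp (Primrec.succ.comp hn)) (Primrec₂.mk ?_)
  refine list_map (Primrec.lettersBelow.comp (hm.comp fst)) (Primrec₂.mk ?_)
  exact ((snd.comp fst).pair snd).pair (primrec_step (hm.comp (fst.comp fst))
    (hT.comp (fst.comp fst)) (snd.comp fst) snd)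

theorem primrec_relatorRuns (hm : Primrec m) (hn : Primrec n) (hT : Primrec T)
    (hR : Primrec R) : Primrec fun p => relatorRuns (m p) (n p) (T p) (R p) := by
  have hrel : Primrec fun p => monoidRelators (m p) (R p) := by
    refine list_append.comp hR (list_map (Primrec.lettersBelow.comp hm) (Primrec₂.mk ?_))
    exact list_cons.comp snd (list_cons.comp
      ((fst.comp snd).pair (Primrec.not.comp (snd.comp snd))) (Primrec.const []))
  refine list_flatMap (list_range.comp (Primrec.succ.comp hn)) (Primrec₂.mk ?_)
  refine list_map (hrel.comp fst) (Primrec₂.mk ?_)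
  exact (snd.comp fst).pair (primrec_run (hm.comp (fst.comp fst)) (hT.comp (fst.comp fst))
    (snd.comp fst) snd)

theorem primrec_overgroupWords (R₀ : List GroupWord) (hm : Primrec m) (hn : Primrec n)
    (hT : Primrec T) (ht : Primrec t) (hF : Primrec F) :
    Primrec fun p => overgroupWords (m p) (n p) (T p) (t p) (F p) R₀ := by
  refine list_append.comp (list_map (Primrec.const R₀)
    (Primrec.substWord.comp (hF.comp fst) snd).to₂)
    (list_map (primrec_transitions hm hn hT) (Primrec₂.mk ?_))
  have ht' : Primrec fun p : α × (ℕ × (ℕ × Bool)) × (ℕ × GroupWord) => t p.1 := ht.comp fst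
  have hq : Primrec fun p : α × (ℕ × (ℕ × Bool)) × (ℕ × GroupWord) => p.2.1 :=
    fst.comp snd
  have hs : Primrec fun p : α × (ℕ × (ℕ × Bool)) × (ℕ × GroupWord) => p.2.2 :=
    snd.comp snd
  exact list_append.comp (list_append.comp (list_append.comp
    ((list_getD []).comp ht' (fst.comp hq))
    (list_cons.comp (snd.comp hq) (Primrec.const [])))
    (Primrec.invRev.comp ((list_getD []).comp ht' (fst.comp hs))))
    (Primrec.invRev.comp (Primrec.substWord.comp (hF.comp fst) (snd.comp hs)))

theorem primrecPred_isValid (k₀ : ℕ) (R₀ : List GroupWord) :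
    PrimrecPred fun p : (ℕ × List GroupWord) × CosetCertificate =>
      IsValid k₀ R₀ p.1.1 p.1.2 p.2 := by
  have hm : Primrec fun p : (ℕ × List GroupWord) × CosetCertificate => p.1.1 := fst.comp fst
  have hR : Primrec fun p : (ℕ × List GroupWord) × CosetCertificate => p.1.2 := snd.comp fst
  have hn : Primrec fun p : (ℕ × List GroupWord) × CosetCertificate => p.2.1 := fst.comp snd
  have h1 : Primrec fun p : (ℕ × List GroupWord) × CosetCertificate => p.2.2 := snd.comp snd
  have hT := fst.comp h1
  have h2 := snd.comp h1
  have ht := fst.comp h2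
  have h3 := snd.comp h2
  have hF := fst.comp h3
  have h4 := snd.comp h3
  have hE₁ := fst.comp h4
  have hE₂ := snd.comp h4
  have hle : PrimrecRel fun (s : (ℕ × (ℕ × Bool)) × (ℕ × GroupWord)) (n : ℕ) => s.2.1 ≤ n :=
    nat_le.comp (fst.comp (snd.comp fst)) snd
  have heq : PrimrecPred fun s : ℕ × (ℕ × GroupWord) => s.2.1 = s.1 :=
    Primrec.eq.comp (fst.comp snd) fst
  have hruns := primrec_relatorRuns hm hn hT hR
  exact (hle.forall_mem_list.comp (primrec_transitions hm hn hT) hn).and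
    ((heq.forall_mem_list.comp hruns).and
    ((Primrec.eq.comp (list_length.comp hF) (Primrec.const k₀)).and
    ((primrecPred_derivesAll hm hR hE₁ (primrec_overgroupWords R₀ hm hn hT ht hF)).and
    (primrecPred_derivesAll (Primrec.const k₀) (Primrec.const R₀) hE₂
      (list_map hruns (snd.comp (snd.comp snd)).to₂)))))

end CosetCertificate

/-- Unbounded search: a decidable relation with a witness has one that can be computed. -/
theorem exists_partrec_search {α β : Type*} [Primcodable α] [Primcodable β]
    {p : α × β → Prop} (hp : ComputablePred p) :
    ∃ s : α →. β, Partrec s ∧ (∀ a, ∀ b ∈ s a, p (a, b)) ∧ ∀ a, (∃ b, p (a, b)) → (s a).Dom := by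
  classical
  let o : α → ℕ → Option β := fun a N =>
    (Encodable.decode (α := β) N).bind fun b => bif decide (p (a, b)) then some b else none
  have ho : Computable₂ o := by
    refine Computable.option_bind (Computable.decode.comp Computable.snd) (Computable₂.mk ?_)
    exact Computable.cond (hp.decide.comp ((Computable.fst.comp Computable.fst).pair
      Computable.snd)) (Computable.option_some.comp Computable.snd) (Computable.const none)
  have hmem {a : α} {N : ℕ} {b : β} (h : b ∈ o a N) : p (a, b) := by
    obtain ⟨b', -, hb⟩ := Option.bind_eq_some_iff.1 h
    by_cases hpb : p (a, b')
    · simp only [hpb, decide_true, cond_true, Option.some.injEq] at hb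
      exact hb ▸ hpb
    · simp [hpb] at hb
  refine ⟨fun a => Nat.rfindOpt (o a), Partrec.rfindOpt ho, fun a b hb => ?_, ?_⟩
  · obtain ⟨N, hN⟩ := Nat.rfindOpt_spec hb
    exact hmem hN
  · rintro a ⟨b, hb⟩
    exact Nat.rfindOpt_dom.2 ⟨Encodable.encode b, b, by simp [o, hb]⟩

/-- A finitely presented group is isomorphic to one that is given by words. -/
theorem exists_mulEquiv_finPresGroup (K : Type*) [Group K] [Group.IsFinitelyPresented K] :
    ∃ (k : ℕ) (R : List GroupWord), Nonempty (K ≃* FinPresGroup k R) := by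
  obtain ⟨k, s, hs, ⟨e⟩⟩ := Group.IsFinitelyPresented.exists_mulEquiv_presentedGroup (G := K)
  choose u hu using exists_wordValue_of_eq (k := k)
  obtain ⟨S, rfl⟩ := hs.exists_finset_coe
  refine ⟨k, S.toList.map u, ⟨e.trans ?_⟩⟩
  have h : (S : Set (FreeGroup (Fin k))) = relatorSet k (S.toList.map u) := by
    ext r
    simp [relatorSet, hu]
  rw [h]

end Search

theorem proposition4p3 (K : Type*) [Group K] [Group.IsFinitelyPresented K]
    (hPCP : PCPDecidable K) (hNPCP : NPCPDecidable K) :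
    (∀ (G : Type*) [Group G], IsVirtually K G → PCPDecidable G) ∧
      UniformPCPDecidableForVirtually K := by
  refine ⟨fun G _ hG => hG.pcpDecidable hPCP hNPCP, ?_⟩
  obtain ⟨k₀, R₀, ⟨e⟩⟩ := exists_mulEquiv_finPresGroup K
  have hdec := TransducerTable.computablePred_reduction
    (hPCP.computablePred e (FinPresGroup.gen k₀ R₀))
    (hNPCP.computablePred e (FinPresGroup.gen k₀ R₀))
  obtain ⟨d, hd, hdeq⟩ := ComputablePred.computable_iff.1 hdec
  obtain ⟨s, hs, hvalid, hdom⟩ :=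
    exists_partrec_search (CosetCertificate.primrecPred_isValid k₀ R₀).computablePred
  have hin : Computable fun p : OvergroupCode × HomPairCode => (p.1.1, p.1.2.1) :=
    ((Primrec.fst.comp Primrec.fst).pair
      (Primrec.fst.comp (Primrec.snd.comp Primrec.fst))).to_comp
  have hout : Computable fun q : (OvergroupCode × HomPairCode) × CosetCertificate =>
      d ((q.1.1.1, q.2.1, q.2.2.1), q.1.2) := by
    refine hd.comp (Primrec.to_comp ?_)
    exact ((Primrec.fst.comp (Primrec.fst.comp Primrec.fst)).pair
      ((Primrec.fst.comp Primrec.snd).pair (Primrec.fst.comp (Primrec.snd.comp Primrec.snd)))).pair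
      (Primrec.snd.comp Primrec.fst)
  refine ⟨_, (hs.comp hin).map hout.to₂, ?_⟩
  rintro ⟨m, R, D⟩ I ⟨f, hf, hfin, -⟩
  have hvirt : IsVirtually (FinPresGroup k₀ R₀) (FinPresGroup m R) := by
    refine ⟨f.comp e.symm.toMonoidHom, hf.comp e.symm.injective, ?_⟩
    have hrange : (f.comp e.symm.toMonoidHom).range = f.range := by
      rw [MonoidHom.range_comp, MonoidHom.range_eq_top.2 e.symm.surjective,
        ← MonoidHom.range_eq_map]
    rwa [hrange]
  obtain ⟨b, hb⟩ := Part.dom_iff_mem.1 (hdom (m, R) (CosetCertificate.exists_isValid hvirt))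
  refine ⟨_, Part.mem_map _ hb, ?_⟩
  obtain ⟨c, hc⟩ := (hvalid _ _ hb).exists_freeCocycle
  rw [hc.pcpSolvable_iff I]
  exact (iff_of_eq (congrFun hdeq ((m, b.1, b.2.1), I))).symm
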